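/- Let $\Delta$ be an irreducible reduced crystallographic root system in a finite-dimensional real vector space $V$, with Weyl group $W$ and a $W$-invariant inner product $(\ ,\ )$, and write $|\mu|^2=(\mu,\mu)$. Let $\Pi=\{\alpha_1,\dots,\alpha_p\}$ be a base of $\Delta$, $\Delta^+$ the set of positive roots, and order the roots by $\mu\preccurlyeq\gamma$ if and only if $\gamma-\mu\in Q^+=\{\sum_i n_i\alpha_i\mid n_i\in\mathbb Z_{\ge 0}\}$. Suppose that $\Delta$ has roots of different lengths; let $\theta$ be the highest root and $\theta_s$ the dominant short root. Write $\theta=\sum_{i=1}^p c_i\alpha_i$, and let $g=\sum_{\alpha_i\ \mathrm{short}}c_i$ be the sum of the coordinates of $\theta$ at the short simple roots. Let $e_1,\dots,e_p$ be the exponents of $W$: if $c$ is a Coxeter element of $W$ (a product of all the simple reflections, each once, in any order) and $h$ is its order, then $0\le e_i<h$ and the eigenvalues of $c$ on $V$, counted with multiplicity, are $\exp(2\pi \sqrt{-1}\,e_i/h)$, $i=1,\dots,p$. A short antichain is a (possibly empty) set of short positive roots that are pairwise incomparable with respect to $\preccurlyeq$. Suppose that $|\theta|^2/|\theta_s|^2=2$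 (equivalently, that $\Delta$ is of type $B_p$ or $C_p$ with $p\ge 2$, or $F_4$). Then the number of short antichains in $\Delta^+$ is $$\prod_{i=1}^p\frac{g+e_i+1}{e_i+1}.$$ -/

import Mathlib

noncomputable section

namespace ShortAntichain

variable {ι M N : Type*} [AddCommGroup M] [Module ℝ M] [AddCommGroup N] [Module ℝ N]
  {P : RootPairing ι ℝ M N}

/-- The root order: `α_i ≼ α_j` when `α_j - α_i` lies in `Q⁺`, the set of linear combinations of
simple roots with coefficients in `ℕ`. -/
def RootLE (b : P.Base) (i j : ι) : Prop :=
  P.root j - P.root i ∈ AddSubmonoid.closure (P.root '' b.support)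

/-- The squared length `(α_i, α_i)` of a root, for a Weyl-invariant form. -/
def sqLength (B : P.InvariantForm) (i : ι) : ℝ :=
  B.form (P.root i) (P.root i)

/-- A root is short if some root is strictly longer. (An irreducible reduced crystallographic root
system has at most two root lengths; if all lengths agree, all roots are counted as long.) -/
def IsShort (B : P.InvariantForm) (i : ι) : Prop :=
  ∃ j, sqLength B i < sqLength B j

/-- `α_i` is the highest root: every root is `≼ α_i`. -/
def IsHighestRoot (b : P.Base) (i : ι) : Prop :=
  ∀ j, RootLE b j i

/-- `α_i` lies in the closed fundamental Weyl chamber. -/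
def IsDominantRoot (b : P.Base) (B : P.InvariantForm) (i : ι) : Prop :=
  ∀ j ∈ b.support, 0 ≤ B.form (P.root i) (P.root j)

/-- The short antichains: sets of pairwise `≼`-incomparable positive roots, all of them short.
The empty set is one of them. -/
def shortAntichains (b : P.Base) (B : P.InvariantForm) : Set (Set ι) :=
  {Γ | (∀ i ∈ Γ, b.IsPos i ∧ IsShort B i) ∧ IsAntichain (RootLE b) Γ}

open Classical in
/-- The sum of the coordinates of `α_i` at the short simple roots, in the basis of simple roots. -/
def shortCoordSum [P.IsRootSystem] (b : P.Base) (B : P.InvariantForm) (i : ι) : ℝ :=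
  ∑ j : b.support, if IsShort B j then b.toWeightBasis.repr (P.root i) j else 0

/-- A Coxeter element: the product, in some order, of all the simple reflections, each of them
occurring once. -/
def IsCoxeterElement (b : P.Base) (c : M ≃ₗ[ℝ] M) : Prop :=
  ∃ l : List ι, l.Nodup ∧ (∀ i, i ∈ l ↔ i ∈ b.support) ∧ c = (l.map P.reflection).prod

/-- For a linear automorphism `c` of finite order `h`, the multiset of the integers
`0 ≤ m < h` for which `exp (2πi m / h)` is an eigenvalue of `c`, with the multiplicity of that
eigenvalue as a root of the characteristic polynomial. When `c` is a Coxeter element, `h` is the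
Coxeter number and these integers are the exponents of the Weyl group. -/
def exponents [FiniteDimensional ℝ M] (c : M ≃ₗ[ℝ] M) : Multiset ℕ :=
  ∑ m ∈ Finset.range (orderOf c),
    Multiset.replicate
      (((c : M →ₗ[ℝ] M).charpoly.map (algebraMap ℝ ℂ)).rootMultiplicity
        (Complex.exp (2 * Real.pi * Complex.I * ((m : ℂ) / (orderOf c : ℂ))))) m

end ShortAntichain

end

/-!
The roots have two lengths, in squared ratio `2`. The proof first determines the Dynkin diagram,
then computes both sides of the formula for each of the three resulting types.

*Classification.* Rescale the form so that short roots have squared length `2` and long roots `4`.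
Two adjacent simple roots then have inner product `-1` if both are short and `-2` otherwise. Start
from a long simple root adjacent to a short one. By positive definiteness, such a path can only be
extended by a long root at its long end or by a short root at its short end
(`IsDoublyLaced.exists_extend`), so the whole diagram is a path of `a` long roots followed by short
ones. The affine extensions of `F₄` being excluded, either exactly one simple root is short (type
`B`), or exactly one is long (type `C`), or there are two of each (`F₄`): this is
`IsDoublyLaced.classification`.

*Short roots.* A vector of the root lattice with nonnegative coordinates and the length of a short
root is a root (`comb_mem_range_root`), by descent along simple reflections. Hence the positive
short roots are the solutions in natural numbers of `q = 2`, where `q` is the quadratic form of the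
path, and the root order is the pointwise order of coordinates (`ncard_shortAntichains`). In
types `B` and `C` the form is a sum of squares, and the solutions form a chain, respectively a
staircase of points in the plane with the product order, whose antichains are counted by a Pascal
type recursion (`ncard_staircase`). In `F₄` there are twelve solutions. With `p` the rank, there are
`p + 1`, `(2p - 1).choose p` and `21` short antichains.

*Highest root.* It is dominant, has squared length `4`, and dominates all other roots. This
determines its coordinates at the short simple roots, and `g` is `2`, `2 (p - 1)` and `6`.

*Exponents.* Split the Cartan matrix into triangular matrices as `U + L` according to the order of
the factors of the Coxeter element `c`. The matrix of `c` is `-U⁻¹ L`, so its characteristic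
polynomial is `det (X U + L)`. This matrix is tridiagonal, and its determinant depends only on the
products of opposite entries, so not on the order of the factors (`charpoly_coxeter`). The result is
`X ^ p + 1` in types `B` and `C`, and `X ^ 4 - X ^ 2 + 1` in type `F₄`. These have simple roots,
which are roots of unity; reading off their arguments gives the exponents `1, 3, …, 2p - 1`,
respectively `1, 5, 7, 11`; in types `B` and `C` the product over the exponents is evaluated by
induction on its number of factors.
-/

noncomputable section

namespace ShortAntichain

/-! ### Counting antichains -/

section Antichains

variable {α β : Type*}

/-- The subsets of `s` whose elements are pairwise `r`-incomparable. -/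
def antichainsIn (r : α → α → Prop) (s : Set α) : Set (Set α) :=
  {Γ | Γ ⊆ s ∧ IsAntichain r Γ}

lemma antichainsIn_finite (r : α → α → Prop) {s : Set α} (hs : s.Finite) :
    (antichainsIn r s).Finite :=
  hs.finite_subsets.subset fun _ h ↦ h.1

@[simp] lemma antichainsIn_empty (r : α → α → Prop) : antichainsIn r ∅ = {∅} := by
  ext Γ
  simp only [antichainsIn, Set.subset_empty_iff, Set.mem_ofPred_eq, Set.mem_singleton_iff]
  exact ⟨fun h ↦ h.1, fun h ↦ ⟨h, h ▸ Set.pairwise_empty _⟩⟩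

/-- An antichain in `insert x s` either avoids `x`, or consists of `x` and an antichain of elements
of `s` incomparable to `x`. -/
lemma ncard_antichainsIn_insert (r : α → α → Prop) {s : Set α} (hs : s.Finite) {x : α}
    (hx : x ∉ s) :
    (antichainsIn r (insert x s)).ncard =
      (antichainsIn r s).ncard + (antichainsIn r {y ∈ s | ¬ r x y ∧ ¬ r y x}).ncard := by
  set t : Set α := {y ∈ s | ¬ r x y ∧ ¬ r y x}
  have ht : t ⊆ s := fun y hy ↦ hy.1
  have hxt : x ∉ t := fun h ↦ hx (ht h)
  have key : antichainsIn r (insert x s) = antichainsIn r s ∪ insert x '' antichainsIn r t := by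
    ext Γ
    constructor
    · rintro ⟨hΓ, ha⟩
      by_cases hxΓ : x ∈ Γ
      · right
        refine ⟨Γ \ {x}, ⟨?_, ha.subset Set.sdiff_subset⟩, by simp [hxΓ]⟩
        rintro y ⟨hy, hyx⟩
        have hyx : y ≠ x := hyx
        exact ⟨(hΓ hy).resolve_left hyx, ha hxΓ hy hyx.symm, ha hy hxΓ hyx⟩
      · left
        exact ⟨fun y hy ↦ (hΓ hy).resolve_left fun h ↦ hxΓ (h ▸ hy), ha⟩
    · rintro (⟨hΓ, ha⟩ | ⟨Γ', ⟨hΓ, ha⟩, rfl⟩)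
      · exact ⟨hΓ.trans (Set.subset_insert _ _), ha⟩
      · refine ⟨Set.insert_subset_insert (hΓ.trans ht), ?_⟩
        refine ha.insert (fun y hy _ ↦ (hΓ hy).2.2) fun y hy _ ↦ (hΓ hy).2.1
  rw [key, Set.ncard_union_eq _ (antichainsIn_finite r hs)
    ((antichainsIn_finite r (hs.subset ht)).image _), Set.InjOn.ncard_image]
  · intro Γ hΓ Γ' hΓ' h
    have h1 : x ∉ Γ := fun h ↦ hxt (hΓ.1 h)
    have h2 : x ∉ Γ' := fun h ↦ hxt (hΓ'.1 h)
    simpa [h1, h2] using congrArg (· \ {x}) h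
  · rw [Set.disjoint_left]
    rintro _ ⟨hΓ, -⟩ ⟨Γ', -, rfl⟩
    exact hx (hΓ (Set.mem_insert _ _))

/-- Order isomorphic posets have equally many antichains. -/
lemma ncard_antichainsIn_image {r : α → α → Prop} {r' : β → β → Prop} (f : α → β) {s : Set α}
    (hf : s.InjOn f) (hr : ∀ x ∈ s, ∀ y ∈ s, r x y ↔ r' (f x) (f y)) :
    (antichainsIn r' (f '' s)).ncard = (antichainsIn r s).ncard := by
  have key : antichainsIn r' (f '' s) = (f '' ·) '' antichainsIn r s := by
    ext Γ
    constructor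
    · rintro ⟨hΓ, ha⟩
      refine ⟨s ∩ f ⁻¹' Γ, ⟨Set.inter_subset_left, ?_⟩, ?_⟩
      · rintro x ⟨hx, hxΓ⟩ y ⟨hy, hyΓ⟩ hxy h
        exact ha hxΓ hyΓ (fun h ↦ hxy (hf hx hy h)) ((hr x hx y hy).1 h)
      · ext y
        constructor
        · rintro ⟨x, ⟨-, hx⟩, rfl⟩
          exact hx
        · intro hy
          obtain ⟨x, hx, rfl⟩ := hΓ hy
          exact ⟨x, ⟨hx, hy⟩, rfl⟩
    · rintro ⟨Γ', ⟨hΓ, ha⟩, rfl⟩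
      refine ⟨Set.image_mono hΓ, ?_⟩
      rintro _ ⟨x, hx, rfl⟩ _ ⟨y, hy, rfl⟩ hxy h
      exact ha hx hy (fun h ↦ hxy (h ▸ rfl)) ((hr x (hΓ hx) y (hΓ hy)).2 h)
  rw [key, Set.InjOn.ncard_image]
  intro Γ hΓ Γ' hΓ' h
  exact (hf.image_eq_image_iff hΓ.1 hΓ'.1).1 h

/-- A chain with `n` elements has `n + 1` antichains. -/
lemma ncard_antichainsIn_of_total {r : α → α → Prop} {s : Set α} (hs : s.Finite)
    (hr : ∀ x ∈ s, ∀ y ∈ s, r x y ∨ r y x) :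
    (antichainsIn r s).ncard = s.ncard + 1 := by
  induction s, hs using Set.Finite.induction_on with
  | empty => simp
  | @insert x s hx hs ih =>
    rw [ncard_antichainsIn_insert r hs hx, Set.ncard_insert_of_notMem hx hs,
      ih fun y hy z hz ↦ hr y (.inr hy) z (.inr hz)]
    have : {y ∈ s | ¬ r x y ∧ ¬ r y x} = ∅ := by
      ext y
      simp only [Set.mem_ofPred_eq, Set.mem_empty_iff_false, iff_false]
      rintro ⟨hy, h1, h2⟩
      exact (hr x (.inl rfl) y (.inr hy)).elim h1 h2
    simp [this]

/-- The number of antichains among the members of a duplicate-free list, computed by splitting on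
whether the head is used. The first argument bounds the length of the list. -/
def countAntichains (r : α → α → Bool) : ℕ → List α → ℕ
  | 0, _ => 1
  | _ + 1, [] => 1
  | k + 1, x :: l => countAntichains r k l + countAntichains r k (l.filter fun y ↦ !r x y && !r y x)

lemma ncard_antichainsIn_list (r : α → α → Bool) (k : ℕ) (l : List α) (hl : l.Nodup)
    (hk : l.length ≤ k) :
    (antichainsIn (fun x y ↦ r x y = true) {x | x ∈ l}).ncard = countAntichains r k l := by
  induction k generalizing l with
  | zero =>
    obtain rfl := List.eq_nil_of_length_eq_zero (Nat.le_zero.1 hk)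
    simp [countAntichains]
  | succ k ih =>
    cases l with
    | nil => simp [countAntichains]
    | cons x l =>
      simp only [List.length_cons, Nat.add_le_add_iff_right] at hk
      have h1 : {y | y ∈ x :: l} = insert x {y | y ∈ l} := by ext; simp
      have h2 : {y | y ∈ l.filter fun y ↦ !r x y && !r y x} =
          {y ∈ {y | y ∈ l} | ¬ r x y = true ∧ ¬ r y x = true} := by
        ext; simp
      rw [h1, ncard_antichainsIn_insert _ l.finite_toSet (List.nodup_cons.1 hl).1, countAntichains,
        ih l hl.of_cons hk, ← h2,
        ih _ (hl.of_cons.filter _) ((List.length_filter_le _ _).trans hk)]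

end Antichains

/-! ### Antichains in a staircase -/

section Staircase

/-- The sum of the first `k` entries of row `s` of Pascal's triangle. -/
def pascalSum (k s : ℕ) : ℕ := ∑ i ∈ Finset.range k, s.choose i

lemma pascalSum_succ (k s : ℕ) : pascalSum (k + 1) s = pascalSum k s + s.choose k :=
  Finset.sum_range_succ _ _

lemma pascalSum_succ_succ (k s : ℕ) :
    pascalSum (k + 1) (s + 1) = pascalSum (k + 1) s + pascalSum k s := by
  induction k with
  | zero => simp [pascalSum]
  | succ k ih =>
    rw [pascalSum_succ, ih, pascalSum_succ (k + 1) s, pascalSum_succ k s, Nat.choose_succ_succ]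
    ring

/-- The part with `N - s ≤ t` of the staircase of points `(j, t)` such that `j ≤ N` and
`-j ≤ t < j`. -/
def staircase (N s : ℕ) : Set (ℕ × ℤ) :=
  {x | x.1 ≤ N ∧ (N : ℤ) - s ≤ x.2 ∧ -(x.1 : ℤ) ≤ x.2 ∧ x.2 < x.1}

lemma staircase_finite (N s : ℕ) : (staircase N s).Finite :=
  ((Set.finite_Iic N).prod (Set.finite_Icc (-(N : ℤ)) N)).subset fun x hx ↦ by
    simp only [staircase, Set.mem_ofPred_eq] at hx
    simp only [Set.mem_prod, Set.mem_Iic, Set.mem_Icc]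
    omega

lemma staircase_top (N : ℕ) : staircase N (2 * N + 1) = staircase N (2 * N) := by
  ext x
  simp only [staircase, Set.mem_ofPred_eq]
  omega

lemma ncard_staircase_zero (s : ℕ) : (antichainsIn (· ≤ ·) (staircase 0 s)).ncard = 1 := by
  have : staircase 0 s = ∅ := by
    ext x
    simp only [staircase, Set.mem_ofPred_eq, Set.mem_empty_iff_false, iff_false]
    omega
  simp [this]

/-- Adding the points of the top row of a staircase one at a time, from right to left: the points
incomparable to `(N + 1, N - u)` among the earlier ones form a smaller staircase. -/
lemma ncard_staircase_add_row (N s u : ℕ) (hu : u ≤ s) (hu' : u ≤ 2 * N + 2) :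
    (antichainsIn (· ≤ ·) (staircase N (s - 1) ∪
      {x | x.1 = N + 1 ∧ (N : ℤ) + 1 - u ≤ x.2 ∧ x.2 < x.1})).ncard =
    (antichainsIn (· ≤ ·) (staircase N (s - 1))).ncard +
      ∑ i ∈ Finset.range u, (antichainsIn (· ≤ ·) (staircase N (i - 1))).ncard := by
  induction u with
  | zero =>
    have : {x : ℕ × ℤ | x.1 = N + 1 ∧ (N : ℤ) + 1 - (0 : ℕ) ≤ x.2 ∧ x.2 < x.1} = ∅ := by
      ext x
      simp only [Set.mem_ofPred_eq, Set.mem_empty_iff_false, iff_false]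
      omega
    rw [this]
    simp
  | succ u ih =>
    have h1 : staircase N (s - 1) ∪
          {x | x.1 = N + 1 ∧ (N : ℤ) + 1 - (u + 1 : ℕ) ≤ x.2 ∧ x.2 < x.1} =
        insert (N + 1, (N : ℤ) - u) (staircase N (s - 1) ∪
          {x | x.1 = N + 1 ∧ (N : ℤ) + 1 - u ≤ x.2 ∧ x.2 < x.1}) := by
      ext ⟨j, t⟩
      simp only [staircase, Set.mem_union, Set.mem_ofPred_eq, Set.mem_insert_iff, Prod.mk.injEq]
      omega
    have hfin : (staircase N (s - 1) ∪
        {x | x.1 = N + 1 ∧ (N : ℤ) + 1 - u ≤ x.2 ∧ x.2 < x.1}).Finite := by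
      refine (staircase_finite N _).union
        (((Set.finite_singleton (N + 1)).prod
          (Set.finite_Icc ((N : ℤ) + 1 - u) (N + 1))).subset fun x hx ↦ ?_)
      simp only [Set.mem_ofPred_eq] at hx
      simp only [Set.mem_prod, Set.mem_singleton_iff, Set.mem_Icc]
      omega
    have h2 : {y ∈ staircase N (s - 1) ∪
          {x | x.1 = N + 1 ∧ (N : ℤ) + 1 - u ≤ x.2 ∧ x.2 < x.1} |
          ¬ (N + 1, (N : ℤ) - u) ≤ y ∧ ¬ y ≤ (N + 1, (N : ℤ) - u)} = staircase N (u - 1) := by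
      ext ⟨j, t⟩
      simp only [staircase, Set.mem_union, Set.mem_ofPred_eq, Prod.mk_le_mk]
      omega
    rw [h1, ncard_antichainsIn_insert _ hfin, h2, ih (by omega) (by omega),
      Finset.sum_range_succ, add_assoc]
    simp only [staircase, Set.mem_union, Set.mem_ofPred_eq]
    omega

lemma ncard_staircase_succ (N s : ℕ) (hs : s ≤ 2 * N + 2) :
    (antichainsIn (· ≤ ·) (staircase (N + 1) s)).ncard =
    (antichainsIn (· ≤ ·) (staircase N (s - 1))).ncard +
      ∑ i ∈ Finset.range s, (antichainsIn (· ≤ ·) (staircase N (i - 1))).ncard := by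
  rw [← ncard_staircase_add_row N s s le_rfl hs]
  congr 2
  ext ⟨j, t⟩
  simp only [staircase, Set.mem_union, Set.mem_ofPred_eq]
  omega

/-- Antichains in a staircase are counted by truncated binomial sums. -/
lemma ncard_staircase_add (N s : ℕ) (hs : s ≤ 2 * N + 1) :
    (antichainsIn (· ≤ ·) (staircase N s)).ncard + pascalSum (s - N - 1) s =
      pascalSum (N + 1) s := by
  induction N generalizing s with
  | zero =>
    rw [ncard_staircase_zero]
    interval_cases s <;> simp [pascalSum]
  | succ N ih =>
    have main : ∀ s ≤ 2 * N + 2, (antichainsIn (· ≤ ·) (staircase (N + 1) s)).ncard +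
        pascalSum (s - (N + 1) - 1) s = pascalSum (N + 1 + 1) s := by
      intro s hs
      induction s with
      | zero =>
        have h0 := ih 0 (by omega)
        rw [ncard_staircase_succ N 0 (by omega)]
        simp [pascalSum, Finset.sum_range_succ'] at h0 ⊢
        exact h0
      | succ s ihs =>
        have h1 := ihs (by omega)
        have h2 := ih s (by omega)
        rw [ncard_staircase_succ N s (by omega)] at h1
        rw [ncard_staircase_succ N (s + 1) (by omega), Finset.sum_range_succ,
          pascalSum_succ_succ, Nat.add_sub_cancel]
        have h3 : pascalSum (s + 1 - (N + 1) - 1) (s + 1) =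
            pascalSum (s - N - 1) s + pascalSum (s - (N + 1) - 1) s := by
          rw [show s + 1 - (N + 1) - 1 = s - N - 1 by omega]
          obtain h | ⟨k, hk⟩ : s - N - 1 = 0 ∨ ∃ k, s - N - 1 = k + 1 :=
            (Nat.eq_zero_or_eq_succ_pred _).imp_right fun h ↦ ⟨_, h⟩
          · rw [h, show s - (N + 1) - 1 = 0 by omega]
            simp [pascalSum]
          · rw [hk, show s - (N + 1) - 1 = k by omega, pascalSum_succ_succ]
        omega
    obtain h | rfl : s ≤ 2 * N + 2 ∨ s = 2 * (N + 1) + 1 := by omega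
    · exact main s h
    · have h1 := main (2 * N + 2) le_rfl
      rw [staircase_top]
      rw [show 2 * N + 2 - (N + 1) - 1 = N by omega] at h1
      rw [show 2 * (N + 1) + 1 - (N + 1) - 1 = N + 1 by omega,
        show 2 * (N + 1) = 2 * N + 2 by ring, pascalSum_succ_succ N (2 * N + 2),
        pascalSum_succ_succ (N + 1) (2 * N + 2)]
      have h2 := pascalSum_succ N (2 * N + 2)
      omega

/-- The full staircase with `N` rows has `(2N + 1).choose N` antichains. -/
lemma ncard_staircase (N : ℕ) :
    (antichainsIn (· ≤ ·) (staircase N (2 * N))).ncard = (2 * N + 1).choose N := by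
  rw [← staircase_top]
  have h := ncard_staircase_add N (2 * N + 1) le_rfl
  rw [show 2 * N + 1 - N - 1 = N by omega, pascalSum_succ] at h
  omega

end Staircase

/-! ### The quadratic form of a doubly laced path -/

/-- The Gram matrix of simple roots forming a path, `a` long roots followed by short ones. Short
roots have squared length `2`, long roots squared length `4`. -/
def gram (a i j : ℕ) : ℤ :=
  if i = j then (if i < a then 4 else 2)
  else if i + 1 = j then (if i < a then -2 else -1)
  else if j + 1 = i then (if j < a then -2 else -1)
  else 0

/-- Entry `i` of the product of the Gram matrix of size `n` with the vector `x`. -/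
def gramRow (n a : ℕ) (x : ℕ → ℤ) (i : ℕ) : ℤ := ∑ j ∈ Finset.range n, gram a i j * x j

/-- The squared length of the vector with coordinates `x 0, …, x (n - 1)`. -/
def gramForm (n a : ℕ) (x : ℕ → ℤ) : ℤ := ∑ i ∈ Finset.range n, x i * gramRow n a x i

lemma gram_comm (a i j : ℕ) : gram a i j = gram a j i := by
  unfold gram
  split_ifs <;> omega

lemma gramRow_of_ge {n a i : ℕ} (x : ℕ → ℤ) (hi : n ≤ i) :
    gramRow n a x i =
      if i = n ∧ 0 < n then (if n ≤ a then -2 else -1) * x (n - 1) else 0 := by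
  induction n with
  | zero => simp [gramRow]
  | succ n ih =>
    rw [gramRow, Finset.sum_range_succ, ← gramRow, ih (by omega)]
    simp only [gram, Nat.add_sub_cancel]
    rw [if_neg (by omega), zero_add]
    split_ifs <;> omega

lemma gramForm_succ (n a : ℕ) (x : ℕ → ℤ) :
    gramForm (n + 1) a x = gramForm n a x + 2 * x n * gramRow n a x n + gram a n n * x n ^ 2 := by
  have h : ∀ i, gramRow (n + 1) a x i = gramRow n a x i + gram a i n * x n := fun i ↦
    Finset.sum_range_succ _ _
  have h2 : ∑ i ∈ Finset.range n, x i * (gram a i n * x n) = x n * gramRow n a x n := by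
    rw [gramRow, Finset.mul_sum]
    refine Finset.sum_congr rfl fun i _ ↦ ?_
    rw [gram_comm]
    ring
  rw [gramForm, Finset.sum_range_succ, h n]
  simp_rw [h, mul_add, Finset.sum_add_distrib]
  rw [h2, ← gramForm]
  ring

lemma gramRow_eq {n a i : ℕ} (x : ℕ → ℤ) (hi : i < n) :
    gramRow n a x i = gram a i i * x i
      + (if 0 < i then gram a i (i - 1) * x (i - 1) else 0)
      + (if i + 1 < n then gram a i (i + 1) * x (i + 1) else 0) := by
  induction n with
  | zero => omega
  | succ n ih =>
    rw [gramRow, Finset.sum_range_succ, ← gramRow]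
    obtain rfl | h := Nat.lt_succ_iff_lt_or_eq.1 hi |>.symm
    · rw [gramRow_of_ge x le_rfl, if_neg (lt_irrefl _)]
      by_cases h0 : 0 < i
      · rw [if_pos ⟨rfl, h0⟩, if_pos h0]
        have : gram a i (i - 1) = if i ≤ a then -2 else -1 := by
          unfold gram
          split_ifs <;> omega
        rw [this]
        ring
      · simp [h0]
    · rw [ih h]
      by_cases h1 : i + 1 < n
      · have : gram a i n = 0 := by unfold gram; split_ifs <;> omega
        rw [this, if_pos h1, if_pos (show i + 1 < n + 1 by omega)]
        ring
      · obtain rfl : n = i + 1 := by omega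
        rw [if_neg h1, if_pos (show i + 1 < i + 1 + 1 by omega)]
        ring

section SumsOfSquares

lemma eq_of_forall_eq_succ {X : ℕ → ℤ} {p q : ℕ} (h : ∀ l, p ≤ l → l < q → X l = X (l + 1))
    {k : ℕ} (hk : p ≤ k) (hkq : k ≤ q) : X k = X q := by
  induction q, hkq using Nat.le_induction with
  | base => rfl
  | succ q hq ih =>
    rw [ih fun l h1 h2 ↦ h l h1 (by omega), h q (by omega) (by omega)]

lemma forall_eq_zero_of_sum_sq {ι : Type*} {s : Finset ι} {d : ι → ℤ}
    (h : ∑ i ∈ s, d i ^ 2 = 0) : ∀ i ∈ s, d i = 0 := fun i hi ↦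
  pow_eq_zero_iff two_ne_zero |>.1
    ((Finset.sum_eq_zero_iff_of_nonneg fun i _ ↦ sq_nonneg (d i)).1 h i hi)

lemma exists_of_sum_sq_eq_one {ι : Type*} [DecidableEq ι] {s : Finset ι} {d : ι → ℤ}
    (h : ∑ i ∈ s, d i ^ 2 = 1) :
    ∃ i ∈ s, (d i = 1 ∨ d i = -1) ∧ ∀ j ∈ s, j ≠ i → d j = 0 := by
  obtain ⟨i, hi, hi0⟩ : ∃ i ∈ s, d i ^ 2 ≠ 0 := Finset.exists_ne_zero_of_sum_ne_zero (by simp [h])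
  rw [← Finset.add_sum_erase s _ hi] at h
  have h1 : 0 ≤ ∑ j ∈ s.erase i, d j ^ 2 := Finset.sum_nonneg fun j _ ↦ sq_nonneg _
  have h2 : 0 ≤ d i ^ 2 := sq_nonneg _
  refine ⟨i, hi, sq_eq_one_iff.1 (by omega), fun j hj hji ↦
    forall_eq_zero_of_sum_sq (by omega) j (Finset.mem_erase.2 ⟨hji, hj⟩)⟩

lemma exists_of_sum_sq_eq_two {s : Finset ℕ} {d : ℕ → ℤ} (h : ∑ i ∈ s, d i ^ 2 = 2) :
    ∃ i ∈ s, ∃ j ∈ s, i < j ∧ (d i = 1 ∨ d i = -1) ∧ (d j = 1 ∨ d j = -1) ∧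
      ∀ k ∈ s, k ≠ i → k ≠ j → d k = 0 := by
  obtain ⟨i, hi, hi0⟩ : ∃ i ∈ s, d i ^ 2 ≠ 0 := Finset.exists_ne_zero_of_sum_ne_zero (by simp [h])
  rw [← Finset.add_sum_erase s _ hi] at h
  have h1 : 0 ≤ ∑ j ∈ s.erase i, d j ^ 2 := Finset.sum_nonneg fun j _ ↦ sq_nonneg _
  have h2 : 0 ≤ d i ^ 2 := sq_nonneg _
  have h3 : d i ≤ 1 := by nlinarith
  have h4 : -1 ≤ d i := by nlinarith
  have h5 : d i = 1 ∨ d i = -1 := by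
    have : d i ≠ 0 := fun h ↦ hi0 (by simp [h])
    omega
  have h6 : d i ^ 2 = 1 := by rcases h5 with h | h <;> simp [h]
  obtain ⟨j, hj, hj1, hj2⟩ := exists_of_sum_sq_eq_one (s := s.erase i) (d := d) (by omega)
  obtain ⟨hji, hj⟩ := Finset.mem_erase.1 hj
  have hk : ∀ k ∈ s, k ≠ i → k ≠ j → d k = 0 := fun k hk hki hkj ↦
    hj2 k (Finset.mem_erase.2 ⟨hki, hk⟩) hkj
  rcases lt_or_gt_of_ne hji with h | h
  · exact ⟨j, hj, i, hi, h, hj1, h5, fun k hk' h1 h2 ↦ hk k hk' h2 h1⟩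
  · exact ⟨i, hi, j, hj, h, h5, hj1, hk⟩

end SumsOfSquares

/-- The coordinate vectors of the positive short roots. -/
def shortVectors (n a : ℕ) : Set (ℕ → ℕ) :=
  {x | (∀ k, n ≤ k → x k = 0) ∧ gramForm n a (fun k ↦ (x k : ℤ)) = 2}

/-! ### One short simple root -/

section TypeB

/-- The coordinates preceded by a zero. -/
def consZero (x : ℕ → ℤ) : ℕ → ℤ
  | 0 => 0
  | k + 1 => x k

lemma gramForm_succ_of_le (m a : ℕ) (hm : m < a) (x : ℕ → ℤ) :
    gramForm (m + 1) a x =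
      2 * ∑ i ∈ Finset.range (m + 1), (consZero x (i + 1) - consZero x i) ^ 2 + 2 * x m ^ 2 := by
  induction m with
  | zero =>
    simp [gramForm, gramRow, gram, hm, consZero]
    ring
  | succ m ih =>
    rw [gramForm_succ, ih (by omega), gramRow_of_ge x le_rfl, Finset.sum_range_succ _ (m + 1)]
    simp [gram, hm, hm.le, consZero]
    ring

/-- When only the last simple root is short, the simple roots are `e₀ - e₁, …, e_N` in orthonormal
coordinates `e`, which makes the form a sum of squares. -/
lemma gramForm_typeB (N : ℕ) (x : ℕ → ℤ) :
    gramForm (N + 1) N x =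
      2 * ∑ i ∈ Finset.range (N + 1), (consZero x (i + 1) - consZero x i) ^ 2 := by
  cases N with
  | zero =>
    simp [gramForm, gramRow, gram, consZero]
    ring
  | succ m =>
    rw [gramForm_succ, gramForm_succ_of_le m (m + 1) (by omega), gramRow_of_ge x le_rfl,
      Finset.sum_range_succ _ (m + 1)]
    simp [gram, consZero]
    ring

/-- The short roots `e_k = α_k + ⋯ + α_N`. -/
def suffixVector (N k : ℕ) : ℕ → ℕ := fun i ↦ if k ≤ i ∧ i ≤ N then 1 else 0

lemma shortVectors_typeB (N : ℕ) :
    shortVectors (N + 1) N = suffixVector N '' Set.Iic N := by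
  ext x
  simp only [shortVectors, gramForm_typeB, Set.mem_ofPred_eq, Set.mem_image, Set.mem_Iic]
  constructor
  · rintro ⟨hx, h⟩
    set Y := consZero fun k ↦ (x k : ℤ) with hY
    have hYs : ∀ k, Y (k + 1) = x k := fun k ↦ rfl
    obtain ⟨i, hi, hi1, hi2⟩ := exists_of_sum_sq_eq_one (s := Finset.range (N + 1))
      (d := fun i ↦ Y (i + 1) - Y i) (by omega)
    simp only [Finset.mem_range] at hi hi2
    have h0 : ∀ k ≤ i, Y k = 0 := fun k hk ↦ by
      exact (eq_of_forall_eq_succ (X := Y) (p := 0) (q := k)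
        (fun l _ hl ↦ by have := hi2 l (by omega) (by omega); omega) le_rfl (Nat.zero_le _)).symm
    have h1 : ∀ k, i + 1 ≤ k → k ≤ N + 1 → Y k = Y (N + 1) := fun k hk hkN ↦
      eq_of_forall_eq_succ
        (fun l h1 hl ↦ by have := hi2 l (by omega) (by omega); omega) hk hkN
    have h2 := h1 (i + 1) le_rfl (by omega)
    refine ⟨i, by omega, funext fun k ↦ ?_⟩
    have h3 := hYs k
    have h4 := hYs i
    have h5 := h0 i le_rfl
    simp only [suffixVector]
    split_ifs with hk
    · have := h1 (k + 1) (by omega) (by omega)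
      omega
    · by_cases hkN : k ≤ N
      · have := h0 (k + 1) (by omega)
        omega
      · rw [hx k (by omega)]
  · rintro ⟨i, hi, rfl⟩
    refine ⟨fun k hk ↦ if_neg (by omega), ?_⟩
    rw [Finset.sum_eq_single_of_mem i (by simp; omega)]
    · cases i <;> simp [consZero, suffixVector, hi]
    · intro j hj hji
      simp only [Finset.mem_range] at hj
      cases j with
      | zero => simp [consZero, suffixVector]; omega
      | succ j =>
        have : suffixVector N i (j + 1) = suffixVector N i j := by
          unfold suffixVector
          split_ifs <;> omega
        simp [consZero, this]

/-- With one short simple root the positive short roots form a chain. -/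
lemma ncard_antichainsIn_typeB (N : ℕ) :
    (antichainsIn (· ≤ ·) (shortVectors (N + 1) N)).ncard = N + 2 := by
  rw [shortVectors_typeB, ncard_antichainsIn_of_total ((Set.finite_Iic N).image _),
    Set.InjOn.ncard_image]
  · rw [← Finset.coe_Iic, Set.ncard_coe_finset, Nat.card_Iic]
  · intro i hi j hj h
    simp only [Set.mem_Iic] at hi hj
    have h1 := congrFun h i
    have h2 := congrFun h j
    simp only [suffixVector] at h1 h2
    split_ifs at h1 h2 <;> omega
  · rintro _ ⟨i, hi, rfl⟩ _ ⟨j, hj, rfl⟩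
    rcases le_total i j with h | h
    · right
      intro k
      simp only [suffixVector]
      split_ifs <;> omega
    · left
      intro k
      simp only [suffixVector]
      split_ifs <;> omega

/-- A dominant vector of squared length `4` has orthonormal coordinates `0` and `1` only, two of
them `1`, so that its last coordinate in simple roots is `2`. -/
lemma last_coord_of_dominant_typeB (N : ℕ) (c : ℕ → ℤ) (h : gramForm (N + 1) N c = 4)
    (hd : ∀ i < N + 1, 0 ≤ gramRow (N + 1) N c i) : c N = 2 := by
  rw [gramForm_typeB] at h
  set Y := consZero c with hY
  have hYs : ∀ k, Y (k + 1) = c k := fun k ↦ rfl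
  have hrow : ∀ i < N, Y (i + 2) - Y (i + 1) ≤ Y (i + 1) - Y i := by
    intro i hi
    have := hd i (by omega)
    rw [gramRow_eq c (by omega), if_pos (show i + 1 < N + 1 by omega)] at this
    have h1 := hYs i
    have h2 : Y (i + 2) = c (i + 1) := rfl
    cases i with
    | zero =>
      have h3 : Y 0 = 0 := rfl
      simp [gram, hi] at this
      simp only [zero_add] at h1 h2 ⊢
      omega
    | succ i =>
      have h3 := hYs i
      have h4 : gram N (i + 1) (i + 1 - 1) = -2 := by
        unfold gram
        split_ifs <;> omega
      rw [if_pos (Nat.succ_pos i), h4] at this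
      simp [gram, hi] at this
      omega
  have hlast : 0 ≤ Y (N + 1) - Y N := by
    have := hd N (by omega)
    rw [gramRow_eq c (by omega), if_neg (lt_irrefl (N + 1))] at this
    have h1 := hYs N
    cases N with
    | zero =>
      have h3 : Y 0 = 0 := rfl
      simp [gram] at this
      omega
    | succ i =>
      have h3 := hYs i
      have h4 : gram (i + 1) (i + 1) (i + 1 - 1) = -2 := by
        unfold gram
        split_ifs <;> omega
      rw [if_pos (Nat.succ_pos i), h4] at this
      simp [gram] at this
      omega
  have hnonneg : ∀ i, i ≤ N → 0 ≤ Y (N - i + 1) - Y (N - i) := by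
    intro i
    induction i with
    | zero => intro _; exact hlast
    | succ i ih =>
      intro hi
      have h1 := ih (by omega)
      have h2 := hrow (N - (i + 1)) (by omega)
      rw [show N - (i + 1) + 1 = N - i by omega, show N - (i + 1) + 2 = N - i + 1 by omega] at h2
      rw [show N - (i + 1) + 1 = N - i by omega]
      omega
  have hsq : ∀ i ∈ Finset.range (N + 1), (Y (i + 1) - Y i) ^ 2 = Y (i + 1) - Y i := by
    intro i hi
    have h1 := Finset.single_le_sum (f := fun i ↦ (Y (i + 1) - Y i) ^ 2)
      (fun i _ ↦ sq_nonneg _) hi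
    simp only [Finset.mem_range] at hi
    have h2 := hnonneg (N - i) (by omega)
    rw [show N - (N - i) = i by omega] at h2
    have h3 : Y (i + 1) - Y i ≤ 1 := by nlinarith
    obtain h | h : Y (i + 1) - Y i = 0 ∨ Y (i + 1) - Y i = 1 := by omega
    all_goals simp [h]
  rw [Finset.sum_congr rfl hsq, Finset.sum_range_sub] at h
  have : Y 0 = 0 := rfl
  have := hYs N
  omega

end TypeB

/-! ### One long simple root -/

section TypeC

/-- The coordinates with the one at index `0` doubled. -/
def doubleFirst (x : ℕ → ℤ) (k : ℕ) : ℤ := if k = 0 then 2 * x 0 else x k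

lemma gramForm_succ_one (m : ℕ) (x : ℕ → ℤ) :
    gramForm (m + 1) 1 x =
      ∑ i ∈ Finset.range m, (doubleFirst x i - doubleFirst x (i + 1)) ^ 2 +
        doubleFirst x m ^ 2 := by
  induction m with
  | zero =>
    simp [gramForm, gramRow, gram, doubleFirst]
    ring
  | succ m ih =>
    rw [gramForm_succ, ih, gramRow_of_ge x le_rfl, Finset.sum_range_succ]
    cases m with
    | zero =>
      simp [gram, doubleFirst]
      ring
    | succ m =>
      simp [gram, doubleFirst]
      ring

/-- When only the first simple root is long, the simple roots are `2 e₀, e₁ - e₀, …, e_N - e_{N-1}`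
in orthonormal coordinates `e`. -/
lemma gramForm_typeC (N : ℕ) (x : ℕ → ℤ) (hx : x (N + 1) = 0) :
    gramForm (N + 1) 1 x =
      ∑ i ∈ Finset.range (N + 1), (doubleFirst x i - doubleFirst x (i + 1)) ^ 2 := by
  rw [gramForm_succ_one, Finset.sum_range_succ]
  simp [doubleFirst, hx]

/-- The short root `e_j + e_t`, or `e_j - e_{-t-1}` if `t` is negative, in simple roots. -/
def staircaseVector (x : ℕ × ℤ) : ℕ → ℕ := fun k ↦
  if k = 0 then (if 0 ≤ x.2 then 1 else 0)
  else (if k ≤ x.1 ∧ -x.2 ≤ k then 1 else 0) + (if (k : ℤ) ≤ x.2 then 1 else 0)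

lemma doubleFirst_staircaseVector (x : ℕ × ℤ) (k : ℕ) :
    doubleFirst (fun k ↦ (staircaseVector x k : ℤ)) k =
      (if k ≤ x.1 ∧ -x.2 ≤ k then 1 else 0) + (if (k : ℤ) ≤ x.2 then 1 else 0) := by
  simp only [doubleFirst, staircaseVector]
  split_ifs <;> omega

lemma shortVectors_typeC (N : ℕ) :
    shortVectors (N + 1) 1 = staircaseVector '' staircase N (2 * N) := by
  ext x
  constructor
  · rintro ⟨hx, h⟩
    rw [gramForm_typeC N _ (by simp [hx])] at h
    set X := doubleFirst fun k ↦ (x k : ℤ) with hX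
    have hX0 : X 0 = 2 * x 0 := rfl
    have hXs : ∀ k, k ≠ 0 → X k = x k := fun k hk ↦ if_neg hk
    have hXN : X (N + 1) = 0 := by rw [hXs _ (by omega), hx _ le_rfl]; rfl
    obtain ⟨i, hi, j, hj, hij, hi1, hj1, hk⟩ := exists_of_sum_sq_eq_two h
    simp only [Finset.mem_range] at hi hj hk
    have h1 : ∀ k, j + 1 ≤ k → k ≤ N + 1 → X k = 0 := fun k h1 h2 ↦ by
      rw [eq_of_forall_eq_succ (X := X) (p := j + 1) (q := N + 1)
        (fun l _ hl ↦ by have := hk l (by omega) (by omega) (by omega); omega) h1 h2, hXN]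
    have h2 : ∀ k, i + 1 ≤ k → k ≤ j → X k = X j := fun k h1 h2 ↦
      eq_of_forall_eq_succ
        (fun l _ hl ↦ by have := hk l (by omega) (by omega) (by omega); omega) h1 h2
    have h3 : ∀ k, k ≤ i → X k = X i := fun k h2 ↦
      eq_of_forall_eq_succ (p := 0)
        (fun l _ hl ↦ by have := hk l (by omega) (by omega) (by omega); omega) (by omega) h2
    have hj' := h1 (j + 1) le_rfl (by omega)
    have hi' := h2 (i + 1) le_rfl (by omega)
    have hjx := hXs j (by omega)
    refine ⟨(j, if X i - X (i + 1) = 1 then (i : ℤ) else -(i : ℤ) - 1), ?_, funext fun k ↦ ?_⟩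
    · simp only [staircase, Set.mem_ofPred_eq]
      split_ifs <;> omega
    · have hd := doubleFirst_staircaseVector
        (j, if X i - X (i + 1) = 1 then (i : ℤ) else -(i : ℤ) - 1) k
      have hk1 := h1 k
      have hk2 := h2 k
      have hk3 := h3 k
      have hk4 := hx k
      have hk5 := hXs k
      generalize hv : staircaseVector
        (j, if X i - X (i + 1) = 1 then (i : ℤ) else -(i : ℤ) - 1) = v at *
      simp only [doubleFirst] at hd
      rcases Nat.eq_zero_or_pos k with rfl | hk0
      · split_ifs at hd <;> omega
      · split_ifs at hd <;> omega
  · rintro ⟨⟨j, t⟩, hjt, rfl⟩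
    simp only [staircase, Set.mem_ofPred_eq] at hjt
    have h0 : ∀ k, N + 1 ≤ k → staircaseVector (j, t) k = 0 := by
      intro k hk
      simp only [staircaseVector]
      split_ifs <;> omega
    refine ⟨h0, ?_⟩
    rw [gramForm_typeC N _ (by simp [h0])]
    set i : ℕ := if 0 ≤ t then t.toNat else (-t - 1).toNat with hi
    have hsq : ∀ k ∈ Finset.range (N + 1),
        (doubleFirst (fun k ↦ (staircaseVector (j, t) k : ℤ)) k -
          doubleFirst (fun k ↦ (staircaseVector (j, t) k : ℤ)) (k + 1)) ^ 2 =
        (if k = j then 1 else 0) + (if k = i then 1 else 0) := by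
      intro k _
      rw [doubleFirst_staircaseVector, doubleFirst_staircaseVector]
      rw [hi]
      split_ifs <;> omega
    rw [Finset.sum_congr rfl hsq, Finset.sum_add_distrib, Finset.sum_ite_eq', Finset.sum_ite_eq',
      if_pos (by simp; omega), if_pos (by rw [hi, Finset.mem_range]; split_ifs <;> omega)]
    rfl

lemma staircaseVector_le_iff {N : ℕ} {x y : ℕ × ℤ} (hx : x ∈ staircase N (2 * N))
    (hy : y ∈ staircase N (2 * N)) : x ≤ y ↔ staircaseVector x ≤ staircaseVector y := by
  obtain ⟨j, t⟩ := x
  obtain ⟨j', t'⟩ := y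
  simp only [staircase, Set.mem_ofPred_eq] at hx hy
  rw [Prod.mk_le_mk]
  constructor
  · intro h k
    simp only [staircaseVector]
    split_ifs <;> omega
  · intro h
    -- Coordinate `j` detects `j ≤ j'`. Depending on the signs of `t` and `t'`, coordinate `t`, `0`
    -- or `-t` detects `t ≤ t'`.
    refine ⟨?_, ?_⟩
    · have h1 := h j
      simp only [staircaseVector] at h1
      split_ifs at h1 <;> omega
    · by_contra ht
      by_cases h0 : 0 ≤ t
      · by_cases h0' : 0 ≤ t'
        · have h1 := h t.toNat
          simp only [staircaseVector] at h1
          split_ifs at h1 <;> omega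
        · have h1 := h 0
          simp only [staircaseVector] at h1
          split_ifs at h1 <;> omega
      · have h1 := h (-t).toNat
        simp only [staircaseVector] at h1
        split_ifs at h1 <;> omega

/-- With one long simple root the positive short roots form a staircase. -/
lemma ncard_antichainsIn_typeC (N : ℕ) :
    (antichainsIn (· ≤ ·) (shortVectors (N + 1) 1)).ncard = (2 * N + 1).choose N := by
  rw [shortVectors_typeC, ← ncard_staircase]
  refine ncard_antichainsIn_image _ (fun x hx y hy h ↦ ?_)
    fun x hx y hy ↦ staircaseVector_le_iff hx hy
  exact le_antisymm ((staircaseVector_le_iff hx hy).2 h.le) ((staircaseVector_le_iff hy hx).2 h.ge)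

/-- A vector of squared length `4` whose last coordinate is at least `2` is `2 e_N`. -/
lemma coord_of_two_le_typeC (N : ℕ) (hN : 0 < N) (c : ℕ → ℤ) (hc : c (N + 1) = 0)
    (h : gramForm (N + 1) 1 c = 4) (hcN : 2 ≤ c N) (k : ℕ) (hk : 1 ≤ k) (hkN : k ≤ N) :
    c k = 2 := by
  rw [gramForm_typeC N c hc, Finset.sum_range_succ] at h
  have hX : ∀ k, k ≠ 0 → doubleFirst c k = c k := fun k hk ↦ if_neg hk
  have h0 : 0 ≤ ∑ i ∈ Finset.range N, (doubleFirst c i - doubleFirst c (i + 1)) ^ 2 :=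
    Finset.sum_nonneg fun i _ ↦ sq_nonneg _
  rw [hX N (by omega), hX (N + 1) (by omega), hc, sub_zero] at h
  have h1 : c N = 2 := by nlinarith
  rw [h1] at h
  have h2 := forall_eq_zero_of_sum_sq (s := Finset.range N)
    (d := fun i ↦ doubleFirst c i - doubleFirst c (i + 1)) (by omega)
  rw [← h1, ← hX k (by omega), ← hX N (by omega)]
  refine eq_of_forall_eq_succ (p := 1) (fun l _ hl ↦ ?_) hk hkN
  have := h2 l (by simpa using hl)
  omega

end TypeC

/-! ### Two long and two short simple roots -/

section TypeF

lemma gramForm_typeF (x : ℕ → ℤ) :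
    gramForm 4 2 x = 4 * x 0 ^ 2 + 4 * x 1 ^ 2 + 2 * x 2 ^ 2 + 2 * x 3 ^ 2 - 4 * (x 0 * x 1)
      - 4 * (x 1 * x 2) - 2 * (x 2 * x 3) := by
  simp [gramForm, gramRow, Finset.sum_range_succ, gram]
  ring

/-- The vector with the given first four coordinates, and zeros after them. -/
def vecFour (q : ℕ × ℕ × ℕ × ℕ) : ℕ → ℕ
  | 0 => q.1
  | 1 => q.2.1
  | 2 => q.2.2.1
  | 3 => q.2.2.2
  | _ => 0

/-- The positive short roots of `F₄` in simple roots. -/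
def shortListF : List (ℕ × ℕ × ℕ × ℕ) :=
  [(0, 0, 1, 0), (0, 0, 0, 1), (0, 0, 1, 1), (0, 1, 1, 0), (0, 1, 1, 1), (1, 1, 1, 0),
   (1, 1, 1, 1), (0, 1, 2, 1), (1, 1, 2, 1), (1, 2, 2, 1), (1, 2, 3, 1), (1, 2, 3, 2)]

lemma mem_shortListF (p q r s : ℕ)
    (h : 4 * (p : ℤ) ^ 2 + 4 * (q : ℤ) ^ 2 + 2 * (r : ℤ) ^ 2 + 2 * (s : ℤ) ^ 2 - 4 * (p * q)
      - 4 * (q * r) - 2 * (r * s) = 2) : (p, q, r, s) ∈ shortListF := by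
  -- Each coordinate is bounded by completing squares in the other three.
  have hp : (p : ℤ) < 2 := by
    nlinarith [sq_nonneg (2 * (s : ℤ) - r), sq_nonneg (3 * (r : ℤ) - 4 * q),
      sq_nonneg (2 * (q : ℤ) - 3 * p)]
  have hq : (q : ℤ) < 3 := by
    nlinarith [sq_nonneg (2 * (s : ℤ) - r), sq_nonneg (3 * (r : ℤ) - 4 * q),
      sq_nonneg (2 * (p : ℤ) - q)]
  have hr : (r : ℤ) < 4 := by
    nlinarith [sq_nonneg (2 * (s : ℤ) - r), sq_nonneg (3 * (q : ℤ) - 2 * r),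
      sq_nonneg (2 * (p : ℤ) - q)]
  have hs : (s : ℤ) < 3 := by
    nlinarith [sq_nonneg (2 * (r : ℤ) - 3 * s), sq_nonneg (3 * (q : ℤ) - 2 * r),
      sq_nonneg (2 * (p : ℤ) - q)]
  have hp : p < 2 := by omega
  have hq : q < 3 := by omega
  have hr : r < 4 := by omega
  have hs : s < 3 := by omega
  clear * - hp hq hr hs h
  interval_cases p <;> interval_cases q <;> interval_cases r <;> interval_cases s <;>
    first | (exfalso; revert h; decide) | decide

lemma shortVectors_typeF : shortVectors 4 2 = vecFour '' {q | q ∈ shortListF} := by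
  ext x
  constructor
  · rintro ⟨hx, h⟩
    rw [gramForm_typeF] at h
    refine ⟨(x 0, x 1, x 2, x 3), mem_shortListF _ _ _ _ h, funext fun k ↦ ?_⟩
    match k with
    | 0 => rfl
    | 1 => rfl
    | 2 => rfl
    | 3 => rfl
    | k + 4 => exact (hx (k + 4) (by omega)).symm
  · rintro ⟨q, hq, rfl⟩
    refine ⟨fun k hk ↦ ?_, ?_⟩
    · obtain ⟨k, rfl⟩ := Nat.exists_eq_add_of_le' hk
      rfl
    · rw [gramForm_typeF]
      simp only [vecFour]
      replace hq : q ∈ shortListF := hq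
      revert q
      decide

/-- The pointwise order on the vectors of `vecFour`, as a computable test. -/
def leFour (p q : ℕ × ℕ × ℕ × ℕ) : Bool :=
  decide (p.1 ≤ q.1 ∧ p.2.1 ≤ q.2.1 ∧ p.2.2.1 ≤ q.2.2.1 ∧ p.2.2.2 ≤ q.2.2.2)

lemma leFour_iff (p q : ℕ × ℕ × ℕ × ℕ) : leFour p q = true ↔ vecFour p ≤ vecFour q := by
  rw [leFour, decide_eq_true_eq]
  constructor
  · rintro ⟨h0, h1, h2, h3⟩ k
    match k with
    | 0 => exact h0
    | 1 => exact h1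
    | 2 => exact h2
    | 3 => exact h3
    | k + 4 => exact le_rfl
  · exact fun h ↦ ⟨h 0, h 1, h 2, h 3⟩

lemma ncard_antichainsIn_typeF : (antichainsIn (· ≤ ·) (shortVectors 4 2)).ncard = 21 := by
  rw [shortVectors_typeF, ncard_antichainsIn_image (r := fun p q ↦ leFour p q = true) _
    (fun p _ q _ h ↦ ?_) fun p _ q _ ↦ leFour_iff p q,
    ncard_antichainsIn_list leFour 12 _ (by decide) le_rfl]
  · decide
  · have h0 := congrFun h 0
    have h1 := congrFun h 1
    have h2 := congrFun h 2
    have h3 := congrFun h 3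
    exact Prod.ext h0 (Prod.ext h1 (Prod.ext h2 h3))

/-- The only dominant vector of squared length `4` is `(2, 3, 4, 2)`. -/
lemma coord_of_dominant_typeF (c : ℕ → ℤ) (hpos : ∀ i < 4, 0 < c i) (h : gramForm 4 2 c = 4)
    (hd : ∀ i < 4, 0 ≤ gramRow 4 2 c i) : c 2 = 4 ∧ c 3 = 2 := by
  have e0 : gramRow 4 2 c 0 = 4 * c 0 - 2 * c 1 := by
    simp [gramRow, Finset.sum_range_succ, gram]; ring
  have e1 : gramRow 4 2 c 1 = 4 * c 1 - 2 * c 0 - 2 * c 2 := by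
    simp [gramRow, Finset.sum_range_succ, gram]; ring
  have e2 : gramRow 4 2 c 2 = 2 * c 2 - 2 * c 1 - c 3 := by
    simp [gramRow, Finset.sum_range_succ, gram]; ring
  have e3 : gramRow 4 2 c 3 = 2 * c 3 - c 2 := by
    simp [gramRow, Finset.sum_range_succ, gram]; ring
  have d0 := hd 0 (by omega)
  have d1 := hd 1 (by omega)
  have d2 := hd 2 (by omega)
  have d3 := hd 3 (by omega)
  have p0 := hpos 0 (by omega)
  have p1 := hpos 1 (by omega)
  have p2 := hpos 2 (by omega)
  have p3 := hpos 3 (by omega)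
  have hsum : c 0 * gramRow 4 2 c 0 + c 1 * gramRow 4 2 c 1 + c 2 * gramRow 4 2 c 2 +
      c 3 * gramRow 4 2 c 3 = 4 := by
    rw [← h, gramForm]
    simp [Finset.sum_range_succ]
  generalize gramRow 4 2 c 0 = m0 at *
  generalize gramRow 4 2 c 1 = m1 at *
  generalize gramRow 4 2 c 2 = m2 at *
  generalize gramRow 4 2 c 3 = m3 at *
  -- The inverse Gram matrix is positive, which bounds the coordinates from below.
  have b0 : m0 ≤ c 0 := by omega
  have b1 : 3 * m1 ≤ c 1 := by omega
  have b2 : 6 * m2 ≤ c 2 := by omega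
  have b3 : 2 * m3 ≤ c 3 := by omega
  have t0 := mul_nonneg p0.le d0
  have t1 := mul_nonneg p1.le d1
  have t2 := mul_nonneg p2.le d2
  have t3 := mul_nonneg p3.le d3
  have u0 : c 0 * m0 ≤ 4 := by linarith
  have u1 : c 1 * m1 ≤ 4 := by linarith
  have u2 : c 2 * m2 ≤ 4 := by linarith
  have u3 : c 3 * m3 ≤ 4 := by linarith
  have hm1 : m1 = 0 := by
    by_contra h
    have h2 : 2 ≤ m1 := by omega
    clear * - h2 b1 u1
    nlinarith
  have hm2 : m2 = 0 := by
    by_contra h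
    have h2 : 1 ≤ m2 := by omega
    clear * - h2 b2 u2
    nlinarith
  have hm3 : m3 < 2 := by
    clear * - b3 u3
    nlinarith
  have hm0 : m0 < 3 := by
    clear * - b0 u0
    nlinarith
  clear t0 t1 t2 t3 u0 u1 u2 u3
  subst hm1 hm2
  interval_cases m3 <;> interval_cases m0 <;> omega

end TypeF

/-! ### Classification of doubly laced diagrams -/

section Classification

variable {I M : Type*} [AddCommGroup M] [Module ℝ M]

lemma form_two_smul (F : LinearMap.BilinForm ℝ M) (x : M) :
    F ((2 : ℝ) • x) ((2 : ℝ) • x) = 4 * F x x := by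
  simp only [map_smul, LinearMap.smul_apply, smul_eq_mul]
  ring

/-- Linearly independent vectors with the metric properties of the simple roots of an irreducible
root system with squared root lengths `2` and `4`; the last field says that the Dynkin diagram is
connected. -/
structure IsDoublyLaced (F : LinearMap.BilinForm ℝ M) (v : I → M) : Prop where
  symm : ∀ x y, F x y = F y x
  pos : ∀ x, x ≠ 0 → 0 < F x x
  linearIndependent : LinearIndependent ℝ v
  length : ∀ i, F (v i) (v i) = 2 ∨ F (v i) (v i) = 4
  short_short : ∀ i j, i ≠ j → F (v i) (v i) = 2 → F (v j) (v j) = 2 →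
    F (v i) (v j) = 0 ∨ F (v i) (v j) = -1
  long : ∀ i j, i ≠ j → F (v i) (v i) = 4 → F (v i) (v j) = 0 ∨ F (v i) (v j) = -2
  connected : ∀ S : Set I, S.Nonempty → (∀ i ∈ S, ∀ j, F (v i) (v j) ≠ 0 → j ∈ S) → S = Set.univ

/-- The Gram matrix of a doubly laced path in which the long roots have negative indices. -/
def pathGram (i j : ℤ) : ℝ :=
  if i = j then (if i < 0 then 4 else 2)
  else if i + 1 = j then (if i < 0 then -2 else -1)
  else if j + 1 = i then (if j < 0 then -2 else -1)
  else 0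

/-- The simple roots `f (-a), …, f (b - 1)` form a path of `a` long roots followed by `b` short
ones. -/
def IsPath (F : LinearMap.BilinForm ℝ M) (v : I → M) (f : ℤ → I) (a b : ℕ) : Prop :=
  ∀ i j : ℤ, -a ≤ i → i < b → -a ≤ j → j < b → F (v (f i)) (v (f j)) = pathGram i j

namespace IsDoublyLaced

variable {F : LinearMap.BilinForm ℝ M} {v : I → M} (h : IsDoublyLaced F v)
include h

lemma add_self (x y : M) : F (x + y) (x + y) = F x x + 2 * F x y + F y y := by
  simp only [map_add, LinearMap.add_apply, h.symm y x]
  ring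

lemma long' {i j : I} (hij : i ≠ j) (hj : F (v j) (v j) = 4) :
    F (v i) (v j) = 0 ∨ F (v i) (v j) = -2 := by
  rw [h.symm]
  exact h.long j i hij.symm hj

lemma nonpos {i j : I} (hij : i ≠ j) : F (v i) (v j) ≤ 0 := by
  rcases h.length i with hi | hi
  · rcases h.length j with hj | hj
    · rcases h.short_short i j hij hi hj with h | h <;> simp [h]
    · rcases h.long' hij hj with h | h <;> simp [h]
  · rcases h.long i j hij hi with h | h <;> simp [h]

/-- By positive definiteness, a vector having coefficient `1` at some simple root has positive
length. -/
lemma false_of_add_self_nonpos {S : Set I} {x : M} (hx : x ∈ Submodule.span ℝ (v '' S)) {y : I}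
    (hy : y ∉ S) (hxy : F (x + v y) (x + v y) ≤ 0) : False := by
  have h0 : x + v y = 0 := by
    by_contra h0
    exact absurd (h.pos _ h0) (not_lt.2 hxy)
  refine h.linearIndependent.notMem_span_image hy ?_
  rw [← neg_eq_of_add_eq_zero_right h0]
  exact Submodule.neg_mem _ hx

variable {f : ℤ → I} {a b : ℕ}

lemma path_injOn (hf : IsPath F v f a b) : Set.InjOn f (Set.Ico (-(a : ℤ)) b) := by
  intro i hi j hj hij
  by_contra hne
  have h1 := hf i j hi.1 hi.2 hj.1 hj.2
  have h2 := h.pos (v (f j)) (h.linearIndependent.ne_zero _)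
  rw [hij] at h1
  have h3 : pathGram i j ≤ 0 := by
    unfold pathGram
    rw [if_neg hne]
    split_ifs <;> norm_num
  linarith

lemma path_ne (hf : IsPath F v f a b) {i j : ℤ} (hi : -(a : ℤ) ≤ i) (hi' : i < b)
    (hj : -(a : ℤ) ≤ j) (hj' : j < b) (hij : i ≠ j) : f i ≠ f j := fun he ↦
  hij (h.path_injOn hf ⟨hi, hi'⟩ ⟨hj, hj'⟩ he)

/-- The test vector `α₋₁ + 2 (α₀ + ⋯ + α_k)`, running from the last long root along the short
ones. It is short enough to limit the simple roots that can be attached at `α_k`. -/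
lemma exists_short_test (hf : IsPath F v f a b) (ha : 0 < a) (k : ℕ) (hk : k < b) :
    ∃ x ∈ Submodule.span ℝ (v '' (f '' Set.Icc (-1) (k : ℤ))), F x x ≤ 4 ∧
      ∀ y, y ∉ f '' Set.Icc (-1) (k : ℤ) → F x (v y) ≤ 2 * F (v (f k)) (v y) := by
  induction k with
  | zero =>
    refine ⟨v (f (-1)) + (2 : ℝ) • v (f 0), Submodule.add_mem _ ?_ (Submodule.smul_mem _ _ ?_),
      ?_, fun y hy ↦ ?_⟩
    · exact Submodule.subset_span ⟨_, ⟨-1, by simp, rfl⟩, rfl⟩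
    · exact Submodule.subset_span ⟨_, ⟨0, by simp, rfl⟩, rfl⟩
    · rw [h.add_self, form_two_smul, map_smul, hf _ _ (by omega) (by omega) (by omega) (by omega),
        hf _ _ (by omega) (by omega) (by omega) (by omega),
        hf _ _ (by omega) (by omega) (by omega) (by omega)]
      norm_num [pathGram]
    · have h1 : F (v (f (-1))) (v y) ≤ 0 := h.nonpos fun he ↦ hy ⟨-1, by simp, he⟩
      simp only [map_add, LinearMap.add_apply, map_smul, LinearMap.smul_apply, smul_eq_mul,
        Nat.cast_zero]
      linarith
  | succ k ih =>
    obtain ⟨x, hx, hxx, hxy⟩ := ih (by omega)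
    have hsub : Set.Icc (-1 : ℤ) k ⊆ Set.Icc (-1 : ℤ) (k + 1 : ℕ) :=
      Set.Icc_subset_Icc_right (by omega)
    refine ⟨x + (2 : ℝ) • v (f (k + 1 : ℕ)), Submodule.add_mem _
      (Submodule.span_mono (Set.image_mono (Set.image_mono hsub)) hx) (Submodule.smul_mem _ _ ?_),
      ?_, fun y hy ↦ ?_⟩
    · exact Submodule.subset_span ⟨_, ⟨(k + 1 : ℕ), ⟨by omega, le_rfl⟩, rfl⟩, rfl⟩
    · have h1 := hxy (f (k + 1 : ℕ)) (by
        rintro ⟨j, hj, he⟩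
        exact h.path_ne hf (by have := hj.1; omega) (by have := hj.2; omega) (by omega)
          (by omega) (by have := hj.2; omega) he)
      rw [hf _ _ (by omega) (by omega) (by omega) (by omega)] at h1
      rw [h.add_self, form_two_smul, map_smul,
        hf _ _ (by omega) (by omega) (by omega) (by omega)]
      have e1 : pathGram (k : ℤ) (k + 1 : ℕ) = -1 := by
        unfold pathGram
        rw [if_neg (by omega), if_pos (by omega), if_neg (by omega)]
      have e2 : pathGram (k + 1 : ℕ) (k + 1 : ℕ) = 2 := by
        unfold pathGram
        rw [if_pos rfl, if_neg (by omega)]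
      rw [e1] at h1
      rw [e2, smul_eq_mul]
      linarith
    · have hy' : y ∉ f '' Set.Icc (-1) (k : ℤ) := fun hh ↦ hy (Set.image_mono hsub hh)
      have h1 := hxy y hy'
      have h2 : F (v (f k)) (v y) ≤ 0 := h.nonpos fun he ↦ hy' ⟨k, by simp, he⟩
      simp only [map_add, LinearMap.add_apply, map_smul, LinearMap.smul_apply, smul_eq_mul]
      linarith

/-- The test vector `α₀ + α₋₁ + ⋯ + α_{-k-1}`, running from the first short root along the long
ones. It limits the simple roots that can be attached at `α_{-k-1}`. -/
lemma exists_long_test (hf : IsPath F v f a b) (hb : 0 < b) (k : ℕ) (hk : k < a) :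
    ∃ x ∈ Submodule.span ℝ (v '' (f '' Set.Icc (-(k : ℤ) - 1) 0)), F x x ≤ 2 ∧
      ∀ y, y ∉ f '' Set.Icc (-(k : ℤ) - 1) 0 → F x (v y) ≤ F (v (f (-(k : ℤ) - 1))) (v y) := by
  induction k with
  | zero =>
    refine ⟨v (f 0) + v (f (-1)), Submodule.add_mem _ ?_ ?_, ?_, fun y hy ↦ ?_⟩
    · exact Submodule.subset_span ⟨_, ⟨0, by simp, rfl⟩, rfl⟩
    · exact Submodule.subset_span ⟨_, ⟨-1, by simp, rfl⟩, rfl⟩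
    · rw [h.add_self, hf _ _ (by omega) (by omega) (by omega) (by omega),
        hf _ _ (by omega) (by omega) (by omega) (by omega),
        hf _ _ (by omega) (by omega) (by omega) (by omega)]
      norm_num [pathGram]
    · have h1 : F (v (f 0)) (v y) ≤ 0 := h.nonpos fun he ↦ hy ⟨0, by simp, he⟩
      simp only [map_add, LinearMap.add_apply, Nat.cast_zero, neg_zero, zero_sub]
      linarith
  | succ k ih =>
    obtain ⟨x, hx, hxx, hxy⟩ := ih (by omega)
    have hsub : Set.Icc (-(k : ℤ) - 1) 0 ⊆ Set.Icc (-((k + 1 : ℕ) : ℤ) - 1) 0 :=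
      Set.Icc_subset_Icc_left (by omega)
    refine ⟨x + v (f (-((k + 1 : ℕ) : ℤ) - 1)), Submodule.add_mem _
      (Submodule.span_mono (Set.image_mono (Set.image_mono hsub)) hx) ?_, ?_, fun y hy ↦ ?_⟩
    · exact Submodule.subset_span ⟨_, ⟨-((k + 1 : ℕ) : ℤ) - 1, ⟨le_rfl, by omega⟩, rfl⟩, rfl⟩
    · have h1 := hxy (f (-((k + 1 : ℕ) : ℤ) - 1)) (by
        rintro ⟨j, hj, he⟩
        exact h.path_ne hf (by have := hj.1; omega) (by have := hj.2; omega) (by omega)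
          (by omega) (by have := hj.1; omega) he)
      rw [hf _ _ (by omega) (by omega) (by omega) (by omega)] at h1
      rw [h.add_self, hf (-((k + 1 : ℕ) : ℤ) - 1) _ (by omega) (by omega) (by omega) (by omega)]
      have e1 : pathGram (-(k : ℤ) - 1) (-((k + 1 : ℕ) : ℤ) - 1) = -2 := by
        unfold pathGram
        rw [if_neg (by omega), if_neg (by omega), if_pos (by omega), if_pos (by omega)]
      have e2 : pathGram (-((k + 1 : ℕ) : ℤ) - 1) (-((k + 1 : ℕ) : ℤ) - 1) = 4 := by
        unfold pathGram
        rw [if_pos rfl, if_pos (by omega)]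
      rw [e1] at h1
      rw [e2]
      linarith
    · have hy' : y ∉ f '' Set.Icc (-(k : ℤ) - 1) 0 := fun hh ↦ hy (Set.image_mono hsub hh)
      have h1 := hxy y hy'
      have h2 : F (v (f (-(k : ℤ) - 1))) (v y) ≤ 0 :=
        h.nonpos fun he ↦ hy' ⟨-(k : ℤ) - 1, by simp, he⟩
      simp only [map_add, LinearMap.add_apply]
      linarith

variable {y : I}

/-- A long root outside the path is orthogonal to its short roots. -/
lemma long_orthogonal_short (hf : IsPath F v f a b) (ha : 0 < a)
    (hy : y ∉ f '' Set.Ico (-(a : ℤ)) b) (hyy : F (v y) (v y) = 4) (k : ℕ) (hk : k < b) :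
    F (v (f k)) (v y) = 0 := by
  have hsub : Set.Icc (-1 : ℤ) k ⊆ Set.Ico (-(a : ℤ)) b := fun j hj ↦ by
    simp only [Set.mem_Icc, Set.mem_Ico] at *; omega
  have hy' : y ∉ f '' Set.Icc (-1 : ℤ) k := fun hh ↦ hy (Set.image_mono hsub hh)
  obtain ⟨x, hx, hxx, hxy⟩ := h.exists_short_test hf ha k hk
  refine (h.long' (fun he ↦ hy ⟨k, by simp; omega, he⟩) hyy).resolve_right fun h2 ↦
    h.false_of_add_self_nonpos hx hy' ?_
  have := hxy y hy'
  rw [h.add_self]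
  linarith

/-- A short root outside the path is orthogonal to its short roots, apart from the last one. -/
lemma short_orthogonal_short (hf : IsPath F v f a b) (ha : 0 < a)
    (hy : y ∉ f '' Set.Ico (-(a : ℤ)) b) (hyy : F (v y) (v y) = 2) (k : ℕ) (hk : k + 1 < b) :
    F (v (f k)) (v y) = 0 := by
  have hsub : Set.Icc (-1 : ℤ) (k + 1 : ℕ) ⊆ Set.Ico (-(a : ℤ)) b := fun j hj ↦ by
    simp only [Set.mem_Icc, Set.mem_Ico] at *; omega
  have hsub' : Set.Icc (-1 : ℤ) k ⊆ Set.Icc (-1 : ℤ) (k + 1 : ℕ) :=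
    Set.Icc_subset_Icc_right (by omega)
  have hy' : y ∉ f '' Set.Icc (-1 : ℤ) (k + 1 : ℕ) := fun hh ↦ hy (Set.image_mono hsub hh)
  obtain ⟨x, hx, hxx, hxy⟩ := h.exists_short_test hf ha k (by omega)
  have hkk : F (v (f k)) (v (f k)) = 2 := by
    rw [hf _ _ (by omega) (by omega) (by omega) (by omega)]
    simp [pathGram]
  refine (h.short_short _ _ (fun he ↦ hy ⟨k, by simp; omega, he⟩) hkk hyy).resolve_right fun h2 ↦
    h.false_of_add_self_nonpos (S := f '' Set.Icc (-1 : ℤ) (k + 1 : ℕ))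
      (x := x + v (f (k + 1 : ℕ))) (Submodule.add_mem _
      (Submodule.span_mono (Set.image_mono (Set.image_mono hsub')) hx)
      (Submodule.subset_span ⟨_, ⟨(k + 1 : ℕ), ⟨by omega, le_rfl⟩, rfl⟩, rfl⟩)) hy' ?_
  have h3 := hxy y fun hh ↦ hy' (Set.image_mono hsub' hh)
  have h4 := hxy (f (k + 1 : ℕ)) (by
    rintro ⟨j, hj, he⟩
    exact h.path_ne hf (by have := hj.1; omega) (by have := hj.2; omega) (by omega)
      (by omega) (by have := hj.2; omega) he)
  rw [hf _ _ (by omega) (by omega) (by omega) (by omega)] at h4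
  have e1 : pathGram (k : ℤ) (k + 1 : ℕ) = -1 := by
    unfold pathGram
    rw [if_neg (by omega), if_pos (by omega), if_neg (by omega)]
  have e2 : pathGram (k + 1 : ℕ) (k + 1 : ℕ) = 2 := by
    unfold pathGram
    rw [if_pos rfl, if_neg (by omega)]
  have h5 : F (v (f (k + 1 : ℕ))) (v y) ≤ 0 := h.nonpos fun he ↦ hy' ⟨_, by simp; omega, he⟩
  rw [h.add_self, h.add_self, hf _ _ (by omega) (by omega) (by omega) (by omega), map_add,
    LinearMap.add_apply, e2]
  rw [e1] at h4
  linarith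

/-- A short root outside the path is orthogonal to its long roots. -/
lemma short_orthogonal_long (hf : IsPath F v f a b) (hb : 0 < b)
    (hy : y ∉ f '' Set.Ico (-(a : ℤ)) b) (hyy : F (v y) (v y) = 2) (k : ℕ) (hk : k < a) :
    F (v (f (-(k : ℤ) - 1))) (v y) = 0 := by
  have hsub : Set.Icc (-(k : ℤ) - 1) 0 ⊆ Set.Ico (-(a : ℤ)) b := fun j hj ↦ by
    simp only [Set.mem_Icc, Set.mem_Ico] at *; omega
  have hy' : y ∉ f '' Set.Icc (-(k : ℤ) - 1) 0 := fun hh ↦ hy (Set.image_mono hsub hh)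
  obtain ⟨x, hx, hxx, hxy⟩ := h.exists_long_test hf hb k hk
  have hkk : F (v (f (-(k : ℤ) - 1))) (v (f (-(k : ℤ) - 1))) = 4 := by
    rw [hf _ _ (by omega) (by omega) (by omega) (by omega), pathGram, if_pos rfl,
      if_pos (by omega)]
  refine (h.long _ _ (fun he ↦ hy ⟨_, by simp; omega, he⟩) hkk).resolve_right fun h2 ↦
    h.false_of_add_self_nonpos hx hy' ?_
  have := hxy y hy'
  rw [h.add_self]
  linarith

/-- A long root outside the path is orthogonal to its long roots, apart from the first one. -/
lemma long_orthogonal_long (hf : IsPath F v f a b) (hb : 0 < b)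
    (hy : y ∉ f '' Set.Ico (-(a : ℤ)) b) (hyy : F (v y) (v y) = 4) (k : ℕ) (hk : k + 1 < a) :
    F (v (f (-(k : ℤ) - 1))) (v y) = 0 := by
  have hsub : Set.Icc (-((k + 1 : ℕ) : ℤ) - 1) 0 ⊆ Set.Ico (-(a : ℤ)) b := fun j hj ↦ by
    simp only [Set.mem_Icc, Set.mem_Ico] at *; omega
  have hsub' : Set.Icc (-(k : ℤ) - 1) 0 ⊆ Set.Icc (-((k + 1 : ℕ) : ℤ) - 1) 0 :=
    Set.Icc_subset_Icc_left (by omega)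
  have hy' : y ∉ f '' Set.Icc (-((k + 1 : ℕ) : ℤ) - 1) 0 := fun hh ↦ hy (Set.image_mono hsub hh)
  obtain ⟨x, hx, hxx, hxy⟩ := h.exists_long_test hf hb k (by omega)
  refine (h.long' (fun he ↦ hy ⟨_, by simp; omega, he⟩) hyy).resolve_right fun h2 ↦
    h.false_of_add_self_nonpos (S := f '' Set.Icc (-((k + 1 : ℕ) : ℤ) - 1) 0)
      (x := (2 : ℝ) • x + v (f (-((k + 1 : ℕ) : ℤ) - 1)))
      (Submodule.add_mem _ (Submodule.smul_mem _ _
      (Submodule.span_mono (Set.image_mono (Set.image_mono hsub')) hx))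
      (Submodule.subset_span ⟨_, ⟨_, ⟨le_rfl, by omega⟩, rfl⟩, rfl⟩)) hy' ?_
  have h3 := hxy y fun hh ↦ hy' (Set.image_mono hsub' hh)
  have h4 := hxy (f (-((k + 1 : ℕ) : ℤ) - 1)) (by
    rintro ⟨j, hj, he⟩
    exact h.path_ne hf (by have := hj.1; omega) (by have := hj.2; omega) (by omega)
      (by omega) (by have := hj.1; omega) he)
  rw [hf _ _ (by omega) (by omega) (by omega) (by omega)] at h4
  have e1 : pathGram (-(k : ℤ) - 1) (-((k + 1 : ℕ) : ℤ) - 1) = -2 := by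
    unfold pathGram
    rw [if_neg (by omega), if_neg (by omega), if_pos (by omega), if_pos (by omega)]
  have e2 : pathGram (-((k + 1 : ℕ) : ℤ) - 1) (-((k + 1 : ℕ) : ℤ) - 1) = 4 := by
    unfold pathGram
    rw [if_pos rfl, if_pos (by omega)]
  have h5 : F (v (f (-((k + 1 : ℕ) : ℤ) - 1))) (v y) ≤ 0 :=
    h.nonpos fun he ↦ hy' ⟨_, by simp; omega, he⟩
  rw [h.add_self, h.add_self, form_two_smul,
    hf _ _ (by omega) (by omega) (by omega) (by omega), map_add,
    LinearMap.add_apply, e2, map_smul, LinearMap.smul_apply, LinearMap.smul_apply, smul_eq_mul,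
    smul_eq_mul]
  rw [e1] at h4
  linarith

/-- A path that misses a simple root can be extended at one of its ends. -/
lemma exists_extend (hf : IsPath F v f a b) (ha : 0 < a) (hb : 0 < b)
    (hne : f '' Set.Ico (-(a : ℤ)) b ≠ Set.univ) :
    ∃ f', IsPath F v f' (a + 1) b ∨ IsPath F v f' a (b + 1) := by
  obtain ⟨_, ⟨k, hk, rfl⟩, y, hky, hy⟩ : ∃ i ∈ f '' Set.Ico (-(a : ℤ)) b, ∃ y,
      F (v i) (v y) ≠ 0 ∧ y ∉ f '' Set.Ico (-(a : ℤ)) b := by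
    by_contra! hcon
    exact hne (h.connected _ ⟨f 0, 0, by simp; omega, rfl⟩ hcon)
  have hyf : ∀ j, -(a : ℤ) ≤ j → j < b → f j ≠ y := fun j h1 h2 he ↦ hy ⟨j, ⟨h1, h2⟩, he⟩
  have hS : ∀ j : ℤ, 0 ≤ j → ∃ m : ℕ, j = m := fun j hj ↦ ⟨j.toNat, by omega⟩
  have hL : ∀ j : ℤ, j < 0 → ∃ m : ℕ, j = -(m : ℤ) - 1 := fun j hj ↦ ⟨(-j - 1).toNat, by omega⟩
  rcases h.length y with hyy | hyy
  · have h0 : ∀ j, -(a : ℤ) ≤ j → j < b - 1 → F (v (f j)) (v y) = 0 := by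
      intro j h1 h2
      rcases lt_or_ge j 0 with h3 | h3
      · obtain ⟨m, rfl⟩ := hL j h3
        exact h.short_orthogonal_long hf hb hy hyy m (by omega)
      · obtain ⟨m, rfl⟩ := hS j h3
        exact h.short_orthogonal_short hf ha hy hyy m (by omega)
    have hk' : k = b - 1 := by
      by_contra hk'
      exact hky (h0 k hk.1 (by have := hk.2; omega))
    have h1 : F (v (f (b - 1))) (v y) = -1 := by
      rw [← hk']
      refine (h.short_short _ _ (hyf k hk.1 hk.2) ?_ hyy).resolve_left hky
      rw [hf _ _ hk.1 hk.2 hk.1 hk.2, pathGram, if_pos rfl, if_neg (by omega)]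
    have hrow : ∀ j, -(a : ℤ) ≤ j → j < b → F (v (f j)) (v y) = pathGram j b := by
      intro j h2 h3
      rcases eq_or_ne j (b - 1) with rfl | h4
      · rw [h1, pathGram, if_neg (by omega), if_pos (by omega), if_neg (by omega)]
      · rw [h0 j h2 (by omega), pathGram, if_neg (by omega), if_neg (by omega), if_neg (by omega)]
    refine ⟨Function.update f b y, .inr fun i j hi hi' hj hj' ↦ ?_⟩
    rcases eq_or_ne i b with rfl | hib <;> rcases eq_or_ne j b with rfl | hjb
    · simp [hyy, pathGram]
    · rw [Function.update_self, Function.update_of_ne hjb, h.symm, hrow j hj (by omega)]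
      unfold pathGram
      split_ifs <;> first | rfl | omega
    · rw [Function.update_self, Function.update_of_ne hib, hrow i hi (by omega)]
    · rw [Function.update_of_ne hib, Function.update_of_ne hjb,
        hf i j hi (by omega) hj (by omega)]
  · have h0 : ∀ j, -(a : ℤ) < j → j < b → F (v (f j)) (v y) = 0 := by
      intro j h1 h2
      rcases lt_or_ge j 0 with h3 | h3
      · obtain ⟨m, rfl⟩ := hL j h3
        exact h.long_orthogonal_long hf hb hy hyy m (by omega)
      · obtain ⟨m, rfl⟩ := hS j h3
        exact h.long_orthogonal_short hf ha hy hyy m (by omega)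
    have hk' : k = -a := by
      by_contra hk'
      exact hky (h0 k (by have := hk.1; omega) hk.2)
    have h1 : F (v (f (-a))) (v y) = -2 := by
      rw [← hk']
      exact (h.long' (hyf k hk.1 hk.2) hyy).resolve_left hky
    have hrow : ∀ j, -(a : ℤ) ≤ j → j < b → F (v (f j)) (v y) = pathGram j (-a - 1) := by
      intro j h2 h3
      rcases eq_or_ne j (-a) with rfl | h4
      · rw [h1, pathGram, if_neg (by omega), if_neg (by omega), if_pos (by omega),
          if_pos (by omega)]
      · rw [h0 j (by omega) h3, pathGram, if_neg (by omega), if_neg (by omega), if_neg (by omega)]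
    refine ⟨Function.update f (-a - 1) y, .inl fun i j hi hi' hj hj' ↦ ?_⟩
    push_cast at hi hj
    rcases eq_or_ne i (-a - 1) with rfl | hib <;> rcases eq_or_ne j (-a - 1) with rfl | hjb
    · rw [Function.update_self, hyy, pathGram, if_pos rfl, if_pos (by omega)]
    · rw [Function.update_self, Function.update_of_ne hjb, h.symm, hrow j (by omega) hj']
      unfold pathGram
      split_ifs <;> first | rfl | omega
    · rw [Function.update_self, Function.update_of_ne hib, hrow i (by omega) hi']
    · rw [Function.update_of_ne hib, Function.update_of_ne hjb,
        hf i j (by omega) hi' (by omega) hj']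

lemma path_card_le [Finite I] (hf : IsPath F v f a b) : a + b ≤ Nat.card I := by
  have h1 := Set.ncard_le_card (f '' Set.Ico (-(a : ℤ)) b)
  rw [(h.path_injOn hf).ncard_image, ← Finset.coe_Ico, Set.ncard_coe_finset, Int.card_Ico] at h1
  omega

/-- If both lengths occur, all simple roots together form a path. -/
lemma exists_path [Finite I] (hshort : ∃ i, F (v i) (v i) = 2) (hlong : ∃ i, F (v i) (v i) = 4) :
    ∃ f a b, 0 < a ∧ 0 < b ∧ IsPath F v f a b ∧ f '' Set.Ico (-(a : ℤ)) b = Set.univ := by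
  -- By connectedness some long root is adjacent to some short root.
  obtain ⟨i, hi, j, hij, hj⟩ : ∃ i ∈ {i | F (v i) (v i) = 4}, ∃ j,
      F (v i) (v j) ≠ 0 ∧ j ∉ {i | F (v i) (v i) = 4} := by
    by_contra! hcon
    obtain ⟨k, hk⟩ := hshort
    have h1 : k ∈ {i | F (v i) (v i) = 4} := by
      rw [h.connected _ hlong hcon]
      trivial
    have h2 : F (v k) (v k) = 4 := h1
    linarith
  have hi : F (v i) (v i) = 4 := hi
  have hj : F (v j) (v j) = 2 := (h.length j).resolve_right hj
  have hne : i ≠ j := by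
    rintro rfl
    linarith
  have hij := (h.long i j hne hi).resolve_left hij
  have hbase : IsPath F v (fun k ↦ if k < 0 then i else j) 1 1 := by
    intro k l hk hk' hl hl'
    obtain rfl | rfl : k = -1 ∨ k = 0 := by omega
    all_goals obtain rfl | rfl : l = -1 ∨ l = 0 := by omega
    all_goals simp [pathGram, hi, hj, hij, h.symm (v j) (v i)]
  -- Extending a path as long as possible terminates.
  have key : ∀ m f a b, 0 < a → 0 < b → IsPath F v f a b → Nat.card I = a + b + m →
      ∃ f a b, 0 < a ∧ 0 < b ∧ IsPath F v f a b ∧ f '' Set.Ico (-(a : ℤ)) b = Set.univ := by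
    intro m
    induction m with
    | zero =>
      intro f a b ha hb hf hm
      refine ⟨f, a, b, ha, hb, hf, ?_⟩
      by_contra hne
      obtain ⟨f', hf' | hf'⟩ := h.exists_extend hf ha hb hne
      all_goals have := h.path_card_le hf'; omega
    | succ m ih =>
      intro f a b ha hb hf hm
      by_cases hne : f '' Set.Ico (-(a : ℤ)) b = Set.univ
      · exact ⟨f, a, b, ha, hb, hf, hne⟩
      · obtain ⟨f', hf' | hf'⟩ := h.exists_extend hf ha hb hne
        · exact ih f' (a + 1) b (by omega) hb hf' (by omega)
        · exact ih f' a (b + 1) ha (by omega) hf' (by omega)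
  have := h.path_card_le hbase
  exact key (Nat.card I - 2) _ 1 1 one_pos one_pos hbase (by omega)

/-- The two affine diagrams extending `F₄` are not positive definite. -/
lemma path_lengths (hf : IsPath F v f a b) (ha : 2 ≤ a) (hb : 2 ≤ b) : a = 2 ∧ b = 2 := by
  -- In each case the coefficients are those of the isotropic vector of an affine diagram.
  constructor
  · by_contra hne
    refine h.false_of_add_self_nonpos (S := f '' Set.Icc (-2) 1) (y := f (-3))
      (x := (2 : ℝ) • v (f (-2)) + (3 : ℝ) • v (f (-1)) + (4 : ℝ) • v (f 0) + (2 : ℝ) • v (f 1))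
      ?_ ?_ ?_
    · have : ∀ k ∈ Set.Icc (-2 : ℤ) 1, v (f k) ∈ Submodule.span ℝ (v '' (f '' Set.Icc (-2) 1)) :=
        fun k hk ↦ Submodule.subset_span ⟨_, ⟨k, hk, rfl⟩, rfl⟩
      refine add_mem (add_mem (add_mem ?_ ?_) ?_) ?_ <;>
        exact Submodule.smul_mem _ _ (this _ (by simp))
    · rintro ⟨j, hj, he⟩
      simp only [Set.mem_Icc] at hj
      exact h.path_ne hf (by omega) (by omega) (by omega) (by omega) (by omega) he
    · have e : ∀ i j, -3 ≤ i → i < 2 → -3 ≤ j → j < 2 →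
          F (v (f i)) (v (f j)) = pathGram i j := fun i j _ _ _ _ ↦
        hf i j (by omega) (by omega) (by omega) (by omega)
      simp only [map_add, LinearMap.add_apply, map_smul, LinearMap.smul_apply, smul_eq_mul]
      rw [e (-2) (-2), e (-2) (-1), e (-2) 0, e (-2) 1, e (-2) (-3), e (-1) (-2), e (-1) (-1),
        e (-1) 0, e (-1) 1, e (-1) (-3), e 0 (-2), e 0 (-1), e 0 0, e 0 1, e 0 (-3), e 1 (-2),
        e 1 (-1), e 1 0, e 1 1, e 1 (-3), e (-3) (-2), e (-3) (-1), e (-3) 0, e (-3) 1,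
        e (-3) (-3)] <;> norm_num [pathGram]
  · by_contra hne
    refine h.false_of_add_self_nonpos (S := f '' Set.Icc (-2) 1) (y := f 2)
      (x := v (f (-2)) + (2 : ℝ) • v (f (-1)) + (3 : ℝ) • v (f 0) + (2 : ℝ) • v (f 1))
      ?_ ?_ ?_
    · have : ∀ k ∈ Set.Icc (-2 : ℤ) 1, v (f k) ∈ Submodule.span ℝ (v '' (f '' Set.Icc (-2) 1)) :=
        fun k hk ↦ Submodule.subset_span ⟨_, ⟨k, hk, rfl⟩, rfl⟩
      refine add_mem (add_mem (add_mem (this _ (by simp)) ?_) ?_) ?_ <;>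
        exact Submodule.smul_mem _ _ (this _ (by simp))
    · rintro ⟨j, hj, he⟩
      simp only [Set.mem_Icc] at hj
      exact h.path_ne hf (by omega) (by omega) (by omega) (by omega) (by omega) he
    · have e : ∀ i j, -2 ≤ i → i < 3 → -2 ≤ j → j < 3 →
          F (v (f i)) (v (f j)) = pathGram i j := fun i j _ _ _ _ ↦
        hf i j (by omega) (by omega) (by omega) (by omega)
      simp only [map_add, LinearMap.add_apply, map_smul, LinearMap.smul_apply, smul_eq_mul]
      rw [e (-2) (-2), e (-2) (-1), e (-2) 0, e (-2) 1, e (-2) 2, e (-1) (-2), e (-1) (-1),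
        e (-1) 0, e (-1) 1, e (-1) 2, e 0 (-2), e 0 (-1), e 0 0, e 0 1, e 0 2, e 1 (-2),
        e 1 (-1), e 1 0, e 1 1, e 1 2, e 2 (-2), e 2 (-1), e 2 0, e 2 1,
        e 2 2] <;> norm_num [pathGram]

/-- The Dynkin diagram is a path of type `B`, `C` or `F₄`, where `n` is the rank and `a` the number
of long simple roots. -/
theorem classification [Finite I] (hshort : ∃ i, F (v i) (v i) = 2)
    (hlong : ∃ i, F (v i) (v i) = 4) :
    ∃ (n a : ℕ) (e : Fin n ≃ I), (∀ i j : Fin n, F (v (e i)) (v (e j)) = gram a i j) ∧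
      0 < a ∧ a < n ∧ (n = a + 1 ∨ a = 1 ∨ (n = 4 ∧ a = 2)) := by
  obtain ⟨f, a, b, ha, hb, hf, huniv⟩ := h.exists_path hshort hlong
  have hbij : Function.Bijective fun i : Fin (a + b) ↦ f (i - a) := by
    constructor
    · intro i j hij
      have := h.path_injOn hf (x₁ := i - a) (x₂ := j - a) (by simp; omega) (by simp; omega) hij
      omega
    · intro y
      obtain ⟨j, hj, rfl⟩ : y ∈ f '' Set.Ico (-(a : ℤ)) b := huniv ▸ Set.mem_univ y
      simp only [Set.mem_Ico] at hj
      refine ⟨⟨(j + a).toNat, by omega⟩, ?_⟩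
      simp only
      congr 1
      omega
  refine ⟨a + b, a, Equiv.ofBijective _ hbij, fun i j ↦ ?_, ha, by omega, ?_⟩
  · have := i.isLt
    have := j.isLt
    simp only [Equiv.ofBijective_apply]
    rw [hf _ _ (by omega) (by omega) (by omega) (by omega)]
    simp only [pathGram, gram]
    split_ifs <;> first | omega | norm_num
  · by_cases h1 : 2 ≤ a
    · by_cases h2 : 2 ≤ b
      · have := h.path_lengths hf h1 h2
        omega
      · omega
    · omega

end IsDoublyLaced

end Classification

/-! ### Roots in coordinates -/

section Roots

variable {ι M N : Type*} [AddCommGroup M] [Module ℝ M] [AddCommGroup N] [Module ℝ N]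
  {P : RootPairing ι ℝ M N}

/-- The integral combination of the simple roots with the given coefficients. -/
def comb (b : P.Base) (x : b.support → ℤ) : M := ∑ j, (x j : ℝ) • P.root j

section Comb

variable (b : P.Base)

lemma comb_add (x y : b.support → ℤ) : comb b (x + y) = comb b x + comb b y := by
  simp [comb, add_smul, Finset.sum_add_distrib]

lemma comb_sub (x y : b.support → ℤ) : comb b (x - y) = comb b x - comb b y := by
  simp [comb, sub_smul, Finset.sum_sub_distrib]

open Classical in
lemma comb_single (i : b.support) (m : ℤ) :
    comb b (Pi.single i m) = (m : ℝ) • P.root i := by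
  rw [comb, Finset.sum_eq_single_of_mem i (Finset.mem_univ i)]
  · simp
  · intro j _ hj
    simp [Pi.single_eq_of_ne hj]

lemma comb_injective : Function.Injective (comb b) := by
  intro x y hxy
  have h := b.linearIndepOn_root.linearIndependent
  rw [Fintype.linearIndependent_iff] at h
  have h0 : ∑ j : b.support, ((x j : ℝ) - y j) • P.root j = 0 := by
    simp only [sub_smul, Finset.sum_sub_distrib]
    exact sub_eq_zero.2 hxy
  ext j
  have := h _ h0 j
  exact_mod_cast sub_eq_zero.1 this

lemma mem_closure_iff (v : M) :
    v ∈ AddSubmonoid.closure (P.root '' b.support) ↔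
      ∃ x : b.support → ℤ, 0 ≤ x ∧ v = comb b x := by
  classical
  constructor
  · intro hv
    induction hv using AddSubmonoid.closure_induction with
    | mem v hv =>
      obtain ⟨i, hi, rfl⟩ := hv
      refine ⟨Pi.single ⟨i, hi⟩ 1, Pi.single_nonneg.2 zero_le_one, ?_⟩
      rw [comb_single]
      simp
    | zero => exact ⟨0, le_rfl, by simp [comb]⟩
    | add v w _ _ hv hw =>
      obtain ⟨x, hx, rfl⟩ := hv
      obtain ⟨y, hy, rfl⟩ := hw
      exact ⟨x + y, add_nonneg hx hy, (comb_add b x y).symm⟩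
  · rintro ⟨x, hx, rfl⟩
    refine sum_mem fun j _ ↦ ?_
    obtain ⟨k, hk⟩ := Int.eq_ofNat_of_zero_le (hx j)
    rw [hk, Int.cast_natCast, Nat.cast_smul_eq_nsmul]
    exact nsmul_mem (AddSubmonoid.subset_closure (Set.mem_image_of_mem _ j.2)) k

lemma rootLE_iff {i j : ι} {x y : b.support → ℤ} (hx : P.root i = comb b x)
    (hy : P.root j = comb b y) : RootLE b i j ↔ x ≤ y := by
  rw [RootLE, mem_closure_iff, hx, hy, ← comb_sub]
  constructor
  · rintro ⟨z, hz, h⟩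
    rw [← comb_injective b h] at hz
    exact sub_nonneg.1 hz
  · intro h
    exact ⟨y - x, sub_nonneg.2 h, rfl⟩

lemma isPos_iff_exists_comb (i : ι) :
    b.IsPos i ↔ ∃ x : b.support → ℤ, 0 ≤ x ∧ P.root i = comb b x := by
  classical
  have key : ∀ x : b.support → ℤ, P.root i = comb b x → b.height i = ∑ j, x j := by
    intro x hx
    have h1 : P.root i = ∑ j ∈ b.support,
        (fun j ↦ if h : j ∈ b.support then x ⟨j, h⟩ else 0) j • P.root j := by
      rw [hx, comb, ← Finset.sum_coe_sort b.support]
      refine Finset.sum_congr rfl fun j _ ↦ ?_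
      simp [Int.cast_smul_eq_zsmul]
    rw [RootPairing.Base.height_eq_sum h1, ← Finset.sum_coe_sort b.support]
    simp
  constructor
  · intro hi
    rcases b.root_mem_or_neg_mem i with h | h
    · exact (mem_closure_iff b _).1 h
    · obtain ⟨x, hx, hx'⟩ := (mem_closure_iff b _).1 h
      have h1 : P.root i = comb b (0 - x) := by
        rw [comb_sub, ← hx']
        simp [comb]
      have h2 := key _ h1
      rw [RootPairing.Base.isPos_iff, h2] at hi
      have h3 : ∑ j, (0 - x) j ≤ 0 := Finset.sum_nonpos fun j _ ↦ by simpa using hx j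
      omega
  · rintro ⟨x, hx, hx'⟩
    rw [RootPairing.Base.isPos_iff', key x hx']
    exact Finset.sum_nonneg fun j _ ↦ hx j

end Comb

section Form

variable (B : P.InvariantForm)

lemma form_comm (x y : M) : B.form x y = B.form y x := by
  simpa using B.symm.eq x y

lemma form_add_self (x y : M) :
    B.form (x + y) (x + y) = B.form x x + 2 * B.form x y + B.form y y := by
  simp only [map_add, LinearMap.add_apply, form_comm B y x]
  ring

lemma two_mul_form_root (x : M) (i : ι) :
    2 * B.form x (P.root i) = P.coroot' i x * B.form (P.root i) (P.root i) := by
  have h := B.apply_reflection_reflection i x (P.root i)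
  rw [RootPairing.reflection_apply_self, RootPairing.reflection_apply] at h
  simp only [map_sub, map_neg, map_smul, LinearMap.sub_apply, LinearMap.smul_apply,
    smul_eq_mul] at h
  linarith

variable (hB : ∀ x : M, x ≠ 0 → 0 < B.form x x)
include hB

lemma sqLength_pos (i : ι) : 0 < sqLength B i := hB _ (P.ne_zero i)

variable [P.IsCrystallographic] [Finite ι]

lemma form_simple_nonpos (b : P.Base) {i j : ι} (hi : i ∈ b.support) (hj : j ∈ b.support)
    (hij : i ≠ j) : B.form (P.root i) (P.root j) ≤ 0 := by
  have h1 := B.two_mul_apply_root_root i j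
  have h2 := b.pairingIn_le_zero_of_ne hij hi hj
  have h3 : P.pairing i j ≤ 0 := by
    rw [← P.algebraMap_pairingIn ℤ, eq_intCast]
    exact_mod_cast h2
  have h4 : 0 < B.form (P.root j) (P.root j) := sqLength_pos B hB j
  nlinarith

/-- A nonnegative combination of simple roots having the least root length is a root: reflecting in
a simple root with which it has positive inner product lowers its height, until it is simple. -/
lemma comb_mem_range_root (b : P.Base) {l : ℝ} (hmin : ∀ i, l ≤ sqLength B i) (hl : 0 < l)
    (x : b.support → ℤ) (hx : 0 ≤ x) (hxl : B.form (comb b x) (comb b x) = l) :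
    comb b x ∈ Set.range P.root := by
  classical
  induction hk : (∑ j, x j).toNat using Nat.strong_induction_on generalizing x with
  | _ k ih =>
  obtain ⟨i, hxi, hi⟩ : ∃ i : b.support, 0 < x i ∧ 0 < B.form (comb b x) (P.root i) := by
    by_contra! hcon
    have h1 : B.form (comb b x) (comb b x) = ∑ i, (x i : ℝ) * B.form (comb b x) (P.root i) := by
      conv_lhs => enter [2]; rw [comb]
      simp
    have h2 : ∑ i, (x i : ℝ) * B.form (comb b x) (P.root i) ≤ 0 := by
      refine Finset.sum_nonpos fun i _ ↦ ?_
      rcases (hx i).lt_or_eq with h | h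
      · exact mul_nonpos_of_nonneg_of_nonpos (by exact_mod_cast hx i) (hcon i h)
      · have h' : x i = 0 := h.symm
        simp [h']
    linarith
  have hBi : l ≤ B.form (P.root i) (P.root i) := hmin i
  obtain ⟨m, hm⟩ : ∃ m : ℤ, P.coroot' i (comb b x) = m := by
    refine ⟨∑ j, x j * P.pairingIn ℤ j i, ?_⟩
    rw [comb, map_sum, Int.cast_sum]
    refine Finset.sum_congr rfl fun j _ ↦ ?_
    rw [map_smul, RootPairing.root_coroot'_eq_pairing, ← P.algebraMap_pairingIn ℤ]
    simp
  have hm2 := two_mul_form_root B (comb b x) i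
  rw [hm] at hm2
  have hm0 : 0 < m := by
    have : (0 : ℝ) < m := by
      by_contra! h
      nlinarith
    exact_mod_cast this
  have hrefl : P.reflection i (comb b x) = comb b (x - Pi.single i m) := by
    rw [comb_sub, comb_single, RootPairing.reflection_apply, hm]
  have hlen : B.form (comb b (x - Pi.single i m)) (comb b (x - Pi.single i m)) = l := by
    rw [← hrefl, B.apply_reflection_reflection, hxl]
  rcases le_or_gt m (x i) with hmx | hmx
  · have hy : 0 ≤ x - Pi.single i m := by
      intro j
      rcases eq_or_ne j i with rfl | hj
      · simpa using hmx
      · simpa [Pi.single_eq_of_ne hj] using hx j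
    have hsum : ∑ j, (x - Pi.single i m : b.support → ℤ) j = ∑ j, x j - m := by
      simp [Finset.sum_sub_distrib]
    have h0 : 0 ≤ ∑ j, (x - Pi.single i m : b.support → ℤ) j := Finset.sum_nonneg fun j _ ↦ hy j
    obtain ⟨j, hj⟩ := ih _ (by omega) _ hy hlen rfl
    refine ⟨P.reflectionPerm i j, ?_⟩
    rw [RootPairing.root_reflectionPerm, hj, ← hrefl, RootPairing.reflection_same]
  · -- Here `x` is supported at `i`, as the reflected vector would otherwise be too long.
    set z : b.support → ℤ := x - Pi.single i (x i) with hz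
    have hzi : B.form (comb b z) (P.root i) ≤ 0 := by
      simp only [comb, map_sum, map_smul, LinearMap.sum_apply, LinearMap.smul_apply, smul_eq_mul]
      refine Finset.sum_nonpos fun j _ ↦ ?_
      rcases eq_or_ne j i with rfl | hj
      · simp [hz]
      · refine mul_nonpos_of_nonneg_of_nonpos ?_
          (form_simple_nonpos B hB b j.2 i.2 fun h ↦ hj (Subtype.ext h))
        simp only [hz, Pi.sub_apply, Pi.single_eq_of_ne hj, sub_zero]
        exact_mod_cast hx j
    have hc : (1 : ℝ) ≤ m - x i := by
      have : 1 ≤ m - x i := by omega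
      exact_mod_cast this
    have hdec : comb b (x - Pi.single i m) = comb b z + (-((m : ℝ) - x i)) • P.root i := by
      simp only [hz, comb_sub, comb_single]
      module
    have hz0 : comb b z = 0 := by
      by_contra h0
      have h1 := hB _ h0
      rw [hdec, form_add_self] at hlen
      simp only [map_smul, LinearMap.smul_apply, smul_eq_mul] at hlen
      generalize (m : ℝ) - x i = t at hc hlen
      have h2 : l ≤ t * B.form (P.root i) (P.root i) := by nlinarith
      have h3 : t * B.form (P.root i) (P.root i) ≤ t * (t * B.form (P.root i) (P.root i)) := by
        nlinarith
      have h4 : t * B.form (comb b z) (P.root i) ≤ 0 := by nlinarith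
      linarith
    have hxz : comb b x = (x i : ℝ) • P.root i := by
      have : comb b x = comb b z + (x i : ℝ) • P.root i := by
        simp only [hz, comb_sub, comb_single]
        module
      rw [this, hz0, zero_add]
    have hx1 : x i = 1 := by
      rw [hxz] at hxl
      simp only [map_smul, LinearMap.smul_apply, smul_eq_mul] at hxl
      by_contra hne
      have h2 : (2 : ℝ) ≤ x i := by
        have : 2 ≤ x i := by omega
        exact_mod_cast this
      have h3 : 2 * l ≤ (x i : ℝ) * B.form (P.root i) (P.root i) := by nlinarith
      nlinarith
    exact ⟨i, by rw [hxz, hx1]; simp⟩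

end Form

section DoublyLaced

variable [Finite ι] [P.IsCrystallographic] [P.IsReduced] [P.IsIrreducible]

lemma isDoublyLaced [P.IsRootSystem] (b : P.Base) (B : P.InvariantForm)
    (hB : ∀ x : M, x ≠ 0 → 0 < B.form x x) {l : ℝ} (hl : 0 < l)
    (hlen : ∀ i, sqLength B i = l ∨ sqLength B i = 2 * l) :
    IsDoublyLaced ((2 / l) • B.form) (fun i : b.support ↦ P.root i) := by
  have happ : ∀ x y, ((2 / l) • B.form) x y = 2 / l * B.form x y := fun x y ↦ rfl
  have hpair : ∀ i j : b.support, i ≠ j →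
      (P.pairingIn ℤ i j, P.pairingIn ℤ j i) ∈
        ({(0, 0), (-1, -1), (-1, -2), (-2, -1), (-1, -3), (-3, -1)} : Set (ℤ × ℤ)) := by
    intro i j hij
    have hij' : (i : ι) ≠ j := fun h ↦ hij (Subtype.ext h)
    have h1 := P.pairingIn_pairingIn_mem_set_of_isCrystal_of_isRed i j
    have h2 := b.pairingIn_le_zero_of_ne hij' i.2 j.2
    have h3 : ¬ (P.pairingIn ℤ i j = -2 ∧ P.pairingIn ℤ j i = -2) := fun h ↦
      b.root_ne_neg_of_ne i.2 j.2 hij' (P.pairingIn_neg_two_neg_two_iff ℤ i j |>.1 h)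
    simp only [Set.mem_insert_iff, Set.mem_singleton_iff, Prod.mk.injEq] at h1 ⊢
    omega
  have hval : ∀ i j : b.support,
      2 * B.form (P.root i) (P.root j) = P.pairingIn ℤ i j * sqLength B j := by
    intro i j
    rw [B.two_mul_apply_root_root, ← P.algebraMap_pairingIn ℤ]
    rfl
  have hscale : ∀ i : b.support, sqLength B i = 2 * l ↔
      ((2 / l) • B.form) (P.root i) (P.root i) = 4 := by
    intro i
    rw [happ, ← sqLength, div_mul_eq_mul_div, div_eq_iff hl.ne']
    constructor <;> intro h <;> linarith
  have hscale' : ∀ i : b.support, sqLength B i = l ↔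
      ((2 / l) • B.form) (P.root i) (P.root i) = 2 := by
    intro i
    rw [happ, ← sqLength, div_mul_eq_mul_div, div_eq_iff hl.ne']
    constructor <;> intro h <;> linarith
  have hadj : ∀ i j : b.support, ∀ t : ℝ, B.form (P.root i) (P.root j) = t * l / 2 →
      ((2 / l) • B.form) (P.root i) (P.root j) = t := by
    intro i j t ht
    rw [happ, ht]
    field_simp
  refine ⟨fun x y ↦ ?_, fun x hx ↦ ?_, b.linearIndepOn_root.linearIndependent, fun i ↦ ?_,
    fun i j hij hi hj ↦ ?_, fun i j hij hi ↦ ?_, fun S ⟨i, hi⟩ hS ↦ ?_⟩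
  · rw [happ, happ, form_comm]
  · rw [happ]
    have := hB x hx
    positivity
  · rw [← hscale, ← hscale']
    exact hlen i
  · have hi := (hscale' i).2 hi
    have hj := (hscale' j).2 hj
    have h1 := hval i j
    have h2 := hval j i
    have h3 := hpair i j hij
    rw [form_comm] at h2
    rw [hj] at h1
    rw [hi] at h2
    simp only [Set.mem_insert_iff, Set.mem_singleton_iff, Prod.mk.injEq] at h3
    rcases h3 with h3 | h3 | h3 | h3 | h3 | h3 <;> rw [h3.1] at h1 <;> rw [h3.2] at h2 <;>
      push_cast at h1 h2
    · exact .inl (hadj i j 0 (by linarith))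
    · exact .inr (hadj i j (-1) (by linarith))
    all_goals linarith
  · have hi := (hscale i).2 hi
    have h1 := hval i j
    have h2 := hval j i
    have h3 := hpair i j hij
    rw [form_comm] at h2
    rw [hi] at h2
    simp only [Set.mem_insert_iff, Set.mem_singleton_iff, Prod.mk.injEq] at h3
    rcases hlen j with hj | hj <;> rw [hj] at h1 <;>
      rcases h3 with h3 | h3 | h3 | h3 | h3 | h3 <;> rw [h3.1] at h1 <;> rw [h3.2] at h2 <;>
      push_cast at h1 h2 <;>
      first
      | linarith
      | exact .inl (hadj i j 0 (by linarith))
      | exact .inr (hadj i j (-2) (by linarith))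
  · refine Set.eq_univ_of_forall fun j ↦ b.induction_on_cartanMatrix (· ∈ S) hi
      fun i j hi hij ↦ hS i hi j ?_
    rw [happ, form_comm]
    refine mul_ne_zero (by positivity) ?_
    rw [Ne, B.apply_root_root_zero_iff, ← b.cartanMatrix_apply_eq_zero_iff_pairing]
    exact hij

omit [P.IsIrreducible] in
/-- Every root length occurs among the simple roots. -/
lemma exists_simple_sqLength_eq (b : P.Base) (B : P.InvariantForm) (i : ι) :
    ∃ j ∈ b.support, sqLength B j = sqLength B i := by
  induction i using b.induction_reflect with
  | h₀ i ih =>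
    obtain ⟨j, hj, h⟩ := ih
    exact ⟨j, hj, by rw [h]; simp [sqLength]⟩
  | h₁ i hi => exact ⟨i, hi, rfl⟩
  | h₂ i j ih _ =>
    obtain ⟨k, hk, h⟩ := ih
    exact ⟨k, hk, by rw [h]; simp [sqLength, RootPairing.root_reflectionPerm]⟩

end DoublyLaced

/-! ### Coordinates along the path of simple roots -/

section Path

variable (b : P.Base) {n : ℕ} (e : Fin n ≃ b.support)

/-- The combination of the simple roots whose coefficients, in the order of the enumeration `e`, are
`x 0, …, x (n - 1)`. -/
def pathComb (x : ℕ → ℕ) : M := ∑ i : Fin n, (x i : ℝ) • P.root (e i)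

lemma pathComb_eq_comb (x : ℕ → ℕ) : pathComb b e x = comb b fun j ↦ (x (e.symm j) : ℤ) := by
  rw [pathComb, comb, ← e.sum_comp]
  simp

/-- A root with nonnegative coordinates, in the order of the enumeration `e`. -/
lemma exists_eq_pathComb {i : ι} (hi : b.IsPos i) :
    ∃ x : ℕ → ℕ, (∀ k, n ≤ k → x k = 0) ∧ P.root i = pathComb b e x := by
  obtain ⟨x, hx, h⟩ := (isPos_iff_exists_comb b i).1 hi
  refine ⟨fun k ↦ if h : k < n then (x (e ⟨k, h⟩)).toNat else 0, fun k hk ↦ dif_neg (by omega), ?_⟩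
  rw [h, pathComb_eq_comb]
  congr 1
  ext j
  simpa using hx j

lemma rootLE_iff_path {i j : ι} {x y : ℕ → ℕ} (hx0 : ∀ k, n ≤ k → x k = 0)
    (hx : P.root i = pathComb b e x) (hy : P.root j = pathComb b e y) :
    RootLE b i j ↔ x ≤ y := by
  rw [pathComb_eq_comb] at hx hy
  rw [rootLE_iff b hx hy]
  constructor
  · intro h k
    by_cases hk : k < n
    · simpa using h (e ⟨k, hk⟩)
    · simp [hx0 k (by omega)]
  · intro h j
    exact Int.ofNat_le.2 (h _)

variable {B : P.InvariantForm} {a : ℕ} {l : ℝ}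
  (he : ∀ i j : Fin n, B.form (P.root (e i)) (P.root (e j)) = l / 2 * gram a i j)
include he

lemma form_pathComb_root (x : ℕ → ℕ) (i : Fin n) :
    B.form (pathComb b e x) (P.root (e i)) = l / 2 * gramRow n a (fun k ↦ (x k : ℤ)) i := by
  rw [gramRow, ← Fin.sum_univ_eq_sum_range (fun j ↦ gram a i j * (x j : ℤ)), pathComb]
  simp only [map_sum, map_smul, LinearMap.sum_apply, LinearMap.smul_apply, smul_eq_mul, he]
  push_cast
  rw [Finset.mul_sum]
  refine Finset.sum_congr rfl fun j _ ↦ ?_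
  rw [gram_comm]
  ring

lemma form_pathComb_self (x : ℕ → ℕ) :
    B.form (pathComb b e x) (pathComb b e x) = l / 2 * gramForm n a (fun k ↦ (x k : ℤ)) := by
  rw [gramForm, ← Fin.sum_univ_eq_sum_range
    (fun i ↦ (x i : ℤ) * gramRow n a (fun k ↦ (x k : ℤ)) i)]
  conv_lhs => enter [2]; rw [pathComb]
  simp only [map_sum, map_smul, smul_eq_mul, form_pathComb_root b e he]
  push_cast
  rw [Finset.mul_sum]
  refine Finset.sum_congr rfl fun j _ ↦ ?_
  ring

variable [P.IsCrystallographic] [Finite ι] (hl : 0 < l)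
  (hlen : ∀ i, sqLength B i = l ∨ sqLength B i = 2 * l)
include hl hlen

omit [P.IsCrystallographic] [Finite ι] he in
lemma isShort_iff {θ : ι} (hθ : sqLength B θ = 2 * l) (i : ι) :
    IsShort B i ↔ sqLength B i = l := by
  constructor
  · rintro ⟨j, hj⟩
    rcases hlen i with h | h
    · exact h
    · rcases hlen j with h' | h' <;> linarith
  · exact fun h ↦ ⟨θ, by linarith⟩

/-- Short antichains correspond to the antichains of coordinate vectors of positive short roots. -/
lemma ncard_shortAntichains (hB : ∀ x : M, x ≠ 0 → 0 < B.form x x) {θ : ι}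
    (hθ : sqLength B θ = 2 * l) :
    (shortAntichains b B).ncard = (antichainsIn (· ≤ ·) (shortVectors n a)).ncard := by
  classical
  have hex : ∀ x ∈ shortVectors n a, ∃ i, P.root i = pathComb b e x := by
    rintro x ⟨-, hx⟩
    have h1 := form_pathComb_self b e he x
    rw [hx, pathComb_eq_comb] at h1
    rw [pathComb_eq_comb]
    refine comb_mem_range_root B hB b (l := l) (fun i ↦ ?_) hl _ (fun j ↦ by simp) ?_
    · rcases hlen i with h | h <;> linarith
    · rw [h1]
      push_cast
      ring
  let g : (ℕ → ℕ) → ι := fun x ↦ if h : ∃ i, P.root i = pathComb b e x then h.choose else θ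
  have hg : ∀ x ∈ shortVectors n a, P.root (g x) = pathComb b e x := by
    intro x hx
    simp only [g, dif_pos (hex x hx)]
    exact (hex x hx).choose_spec
  have hle : ∀ x ∈ shortVectors n a, ∀ y ∈ shortVectors n a, x ≤ y ↔ RootLE b (g x) (g y) :=
    fun x hx y hy ↦ (rootLE_iff_path b e hx.1 (hg x hx) (hg y hy)).symm
  have himg : g '' shortVectors n a = {i | b.IsPos i ∧ IsShort B i} := by
    ext i
    constructor
    · rintro ⟨x, hx, rfl⟩
      refine ⟨(isPos_iff_exists_comb b _).2 ⟨_, fun j ↦ ?_, (hg x hx).trans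
        (pathComb_eq_comb b e x)⟩, ?_⟩
      · simp
      · rw [isShort_iff hl hlen hθ, sqLength, hg x hx, form_pathComb_self b e he, hx.2]
        push_cast
        ring
    · rintro ⟨h1, h2⟩
      obtain ⟨x, hx0, hx⟩ := exists_eq_pathComb b e h1
      rw [isShort_iff hl hlen hθ, sqLength, hx, form_pathComb_self b e he] at h2
      have hx' : x ∈ shortVectors n a := by
        refine ⟨hx0, ?_⟩
        have h3 : (gramForm n a (fun k ↦ (x k : ℤ)) : ℝ) = 2 := by
          have : l * gramForm n a (fun k ↦ (x k : ℤ)) = l * 2 := by linarith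
          exact mul_left_cancel₀ hl.ne' this
        exact_mod_cast h3
      exact ⟨x, hx', P.root.injective (by rw [hg x hx', hx])⟩
  rw [← ncard_antichainsIn_image g (fun x hx y hy hxy ↦ ?_) hle, himg]
  · rfl
  · have h1 : RootLE b (g x) (g y) := by rw [hxy, RootLE]; simp
    have h2 : RootLE b (g y) (g x) := by rw [hxy, RootLE]; simp
    exact le_antisymm ((hle x hx y hy).2 h1) ((hle y hy x hx).2 h2)

end Path

/-! ### The highest root -/

section Highest

variable {b : P.Base} {n : ℕ} {e : Fin n ≃ b.support} {θ : ι} (hθ : IsHighestRoot b θ)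

include hθ in
lemma isPos_of_isHighestRoot : b.IsPos θ := by
  obtain ⟨j, hj⟩ : b.support.Nonempty := by
    have : Nonempty ι := ⟨θ⟩
    exact b.support_nonempty
  rw [isPos_iff_exists_comb]
  obtain ⟨y, hy, hy'⟩ := (mem_closure_iff b _).1 (hθ j)
  obtain ⟨z, hz, hz'⟩ := (isPos_iff_exists_comb b j).1 (b.isPos_of_mem_support hj)
  exact ⟨y + z, add_nonneg hy hz, by rw [comb_add, ← hy', ← hz']; abel⟩

variable {B : P.InvariantForm} {a : ℕ} {l : ℝ}
  (he : ∀ i j : Fin n, B.form (P.root (e i)) (P.root (e j)) = l / 2 * gram a i j)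
  (hl : 0 < l) {c : ℕ → ℕ} (hc : P.root θ = pathComb b e c)

include hθ hc in
lemma highest_coord_pos (i : Fin n) : 0 < c i := by
  have h0 : P.root (e i) = pathComb b e (Pi.single (i : ℕ) 1) := by
    rw [pathComb, Finset.sum_eq_single_of_mem i (Finset.mem_univ i)]
    · simp
    · intro j _ hj
      simp [Pi.single_eq_of_ne (Fin.val_ne_of_ne hj)]
  have h1 := (rootLE_iff_path b e (fun k hk ↦ Pi.single_eq_of_ne (by omega) _) h0 hc).1 (hθ (e i)) i
  rwa [Pi.single_eq_same] at h1

include hθ he hl hc in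
/-- The highest root is dominant, because its reflections do not exceed it. -/
lemma highest_gramRow_nonneg [P.IsCrystallographic] (i : Fin n) :
    0 ≤ gramRow n a (fun k ↦ (c k : ℤ)) i := by
  classical
  have h1 := hθ (P.reflectionPerm (e i) θ)
  have h2 : P.root θ - P.root (P.reflectionPerm (e i) θ) =
      comb b (Pi.single (e i) (P.pairingIn ℤ θ (e i))) := by
    rw [comb_single, RootPairing.root_reflectionPerm, RootPairing.reflection_apply_root,
      ← P.algebraMap_pairingIn ℤ]
    simp
  rw [RootLE, h2, mem_closure_iff] at h1
  obtain ⟨x, hx, h3⟩ := h1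
  rw [← comb_injective b h3] at hx
  have h4 : (0 : ℝ) ≤ P.pairing θ (e i) := by
    rw [← P.algebraMap_pairingIn ℤ, eq_intCast]
    exact_mod_cast Pi.single_nonneg.1 hx
  have h5 := B.two_mul_apply_root_root θ (e i)
  rw [he, hc, form_pathComb_root b e he] at h5
  have h6 : (0 : ℝ) < gram a i i := by
    unfold gram
    split_ifs <;> first | contradiction | norm_num
  have h7 : (0 : ℝ) ≤ gramRow n a (fun k ↦ (c k : ℤ)) i := by
    have h8 : l * gramRow n a (fun k ↦ (c k : ℤ)) i =
        l * (P.pairing θ (e i) * gram a i i / 2) := by linarith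
    rw [mul_left_cancel₀ hl.ne' h8]
    positivity
  exact_mod_cast h7

variable (hlen : ∀ i, sqLength B i = l ∨ sqLength B i = 2 * l) (hθl : sqLength B θ = 2 * l)

include he hl hc hθl in
lemma gramForm_highest : gramForm n a (fun k ↦ (c k : ℤ)) = 4 := by
  have h1 := form_pathComb_self b e he c
  rw [← hc, ← sqLength, hθl] at h1
  have h2 : (gramForm n a (fun k ↦ (c k : ℤ)) : ℝ) = 4 := by
    have h3 : l * gramForm n a (fun k ↦ (c k : ℤ)) = l * 4 := by linarith
    exact mul_left_cancel₀ hl.ne' h3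
  exact_mod_cast h2

include he hl hlen hθl hc in
lemma shortCoordSum_eq [P.IsRootSystem] :
    shortCoordSum b B θ = ∑ i ∈ Finset.range n, if i < a then 0 else (c i : ℝ) := by
  classical
  rw [← Fin.sum_univ_eq_sum_range (fun i ↦ if i < a then 0 else (c i : ℝ)), shortCoordSum,
    ← e.sum_comp]
  refine Finset.sum_congr rfl fun i _ ↦ ?_
  have h1 : b.toWeightBasis.repr (P.root θ) (e i) = c i := by
    rw [hc, pathComb, map_sum, Finsupp.finsetSum_apply, Finset.sum_eq_single_of_mem i (by simp)]
    · simp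
    · intro j _ hj
      rw [map_smul, b.toWeightBasis_repr_root, Finsupp.smul_apply,
        Finsupp.single_eq_of_ne (by simpa using hj.symm), smul_zero]
  have h2 : IsShort B (e i) ↔ ¬ (i : ℕ) < a := by
    rw [isShort_iff hl hlen hθl, sqLength, he, gram, if_pos rfl]
    split_ifs with h
    · simp only [h, not_true_eq_false, iff_false]
      push_cast
      intro h
      linarith
    · simp [h]
  rw [h1]
  by_cases h : (i : ℕ) < a
  · rw [if_neg (by simp [h2, h]), if_pos h]
  · rw [if_pos (h2.2 h), if_neg h]

include hθ he hl hlen hθl in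
lemma shortCoordSum_typeB [P.IsRootSystem] [P.IsCrystallographic] (hn : n = a + 1) :
    shortCoordSum b B θ = 2 := by
  subst hn
  obtain ⟨c, -, hc⟩ := exists_eq_pathComb b e (isPos_of_isHighestRoot hθ)
  have h1 := last_coord_of_dominant_typeB a _ (gramForm_highest he hl hc hθl)
    fun i hi ↦ highest_gramRow_nonneg hθ he hl hc ⟨i, hi⟩
  rw [shortCoordSum_eq he hl hc hlen hθl, Finset.sum_range_succ, if_neg (lt_irrefl a),
    Finset.sum_eq_zero fun i hi ↦ if_pos (Finset.mem_range.1 hi), zero_add]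
  exact_mod_cast h1

/-- With one long simple root, `α₀ + 2 α₁ + ⋯ + 2 α_k` is a root, a reflection of the long simple
root `α₀`. -/
lemma exists_root_typeC {N : ℕ} {e : Fin (N + 1) ≃ b.support}
    (he : ∀ i j : Fin (N + 1), B.form (P.root (e i)) (P.root (e j)) = l / 2 * gram 1 i j)
    (hl : 0 < l) (k : ℕ) (hk : k ≤ N) :
    ∃ i, P.root i = pathComb b e fun j ↦ if j = 0 then 1 else if j ≤ k then 2 else 0 := by
  induction k with
  | zero =>
    refine ⟨e 0, ?_⟩
    rw [pathComb, Finset.sum_eq_single_of_mem 0 (Finset.mem_univ _)]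
    · simp
    · intro j _ hj
      have : (j : ℕ) ≠ 0 := fun h ↦ hj (Fin.ext h)
      simp [this]
  | succ k ih =>
    obtain ⟨i, hi⟩ := ih (by omega)
    have hk' : k + 1 < N + 1 := by omega
    refine ⟨P.reflectionPerm (e ⟨k + 1, hk'⟩) i, ?_⟩
    have h1 := two_mul_form_root B (P.root i) (e ⟨k + 1, hk'⟩)
    rw [he, hi, form_pathComb_root b e he, gramRow_eq _ hk'] at h1
    have h2 : gram 1 (k + 1) (k + 1 - 1) = if k = 0 then -2 else -1 := by
      unfold gram
      split_ifs <;> omega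
    have h3 : gram 1 (k + 1) (k + 1) = 2 := by
      unfold gram
      split_ifs <;> omega
    have h4 : P.coroot' (e ⟨k + 1, hk'⟩) (P.root i) = -2 := by
      rw [h2, h3, ← hi] at h1
      have h5 : l * P.coroot' (e ⟨k + 1, hk'⟩) (P.root i) = l * (-2) := by
        rcases Nat.eq_zero_or_pos k with rfl | h0
        · simp at h1 ⊢
          linarith
        · simp [h0.ne'] at h1 ⊢
          linarith
      exact mul_left_cancel₀ hl.ne' h5
    rw [RootPairing.root_reflectionPerm, RootPairing.reflection_apply, h4, hi]
    have h6 : P.root (e ⟨k + 1, hk'⟩) =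
        ∑ j : Fin (N + 1), (if (j : ℕ) = k + 1 then (1 : ℝ) else 0) • P.root (e j) := by
      rw [Finset.sum_eq_single_of_mem ⟨k + 1, hk'⟩ (Finset.mem_univ _)]
      · simp
      · intro j _ hj
        have : (j : ℕ) ≠ k + 1 := fun h ↦ hj (Fin.ext h)
        simp [this]
    rw [h6, pathComb, pathComb, Finset.smul_sum, ← Finset.sum_sub_distrib]
    refine Finset.sum_congr rfl fun j _ ↦ ?_
    rw [smul_smul, ← sub_smul]
    congr 1
    push_cast
    split_ifs <;> first | omega | norm_num

include hθ he hl hlen hθl in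
lemma shortCoordSum_typeC [P.IsRootSystem] [P.IsCrystallographic] (ha : a = 1) (hn : 1 < n) :
    shortCoordSum b B θ = 2 * (n - 1 : ℝ) := by
  subst ha
  obtain ⟨N, rfl⟩ : ∃ N, n = N + 1 := ⟨n - 1, by omega⟩
  obtain ⟨c, hc0, hc⟩ := exists_eq_pathComb b e (isPos_of_isHighestRoot hθ)
  obtain ⟨i, hi⟩ := exists_root_typeC he hl N le_rfl
  have h1 := (rootLE_iff_path b e (fun k hk ↦ by
    rw [if_neg (by omega), if_neg (by omega)]) hi hc).1 (hθ i) N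
  beta_reduce at h1
  rw [if_neg (by omega), if_pos le_rfl] at h1
  have h2 := coord_of_two_le_typeC N (by omega) (fun k ↦ (c k : ℤ)) (by simp [hc0])
    (gramForm_highest he hl hc hθl) (by exact_mod_cast h1)
  rw [shortCoordSum_eq he hl hc hlen hθl, Finset.sum_range_succ', if_pos one_pos, add_zero,
    Finset.sum_congr rfl (g := fun _ ↦ (2 : ℝ))]
  · simp
    ring
  · intro k hk
    rw [if_neg (by omega)]
    exact_mod_cast h2 (k + 1) (by omega) (by have := Finset.mem_range.1 hk; omega)

include hθ he hl hlen hθl in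
lemma shortCoordSum_typeF [P.IsRootSystem] [P.IsCrystallographic] (ha : a = 2) (hn : n = 4) :
    shortCoordSum b B θ = 6 := by
  subst ha hn
  obtain ⟨c, -, hc⟩ := exists_eq_pathComb b e (isPos_of_isHighestRoot hθ)
  obtain ⟨h2, h3⟩ := coord_of_dominant_typeF (fun k ↦ (c k : ℤ))
    (fun i hi ↦ by exact_mod_cast highest_coord_pos hθ hc ⟨i, hi⟩)
    (gramForm_highest he hl hc hθl) fun i hi ↦ highest_gramRow_nonneg hθ he hl hc ⟨i, hi⟩
  have h2 : c 2 = 4 := by exact_mod_cast h2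
  have h3 : c 3 = 2 := by exact_mod_cast h3
  rw [shortCoordSum_eq he hl hc hlen hθl]
  simp [Finset.sum_range_succ, h2, h3]
  norm_num

end Highest

end Roots

open Polynomial

/-! ### Tridiagonal determinants -/

section Tridiagonal

variable {R : Type*} [CommRing R]

/-- The determinant of a tridiagonal matrix of size `n` with constant diagonal `d`, as a function of
the products `w i` of its off-diagonal entries at `(i, i + 1)` and `(i + 1, i)`. -/
def continuant (d : R) : ℕ → (ℕ → R) → R
  | 0, _ => 1
  | 1, _ => d
  | n + 2, w => d * continuant d (n + 1) (fun i ↦ w (i + 1)) -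
      w 0 * continuant d n fun i ↦ w (i + 2)

lemma det_eq_continuant (d : R) (n : ℕ) (A : Matrix (Fin n) (Fin n) R) (w : ℕ → R)
    (hd : ∀ i, A i i = d) (hw : ∀ i j : Fin n, (j : ℕ) = i + 1 → A i j * A j i = w i)
    (h0 : ∀ i j : Fin n, (i : ℕ) + 1 < j ∨ (j : ℕ) + 1 < i → A i j = 0) :
    A.det = continuant d n w := by
  induction n using Nat.strong_induction_on generalizing w with
  | _ n ih =>
  match n with
  | 0 => simp [continuant]
  | 1 => simp [continuant, hd]
  | n + 2 =>
    have hs : (A.submatrix Fin.succ Fin.succ).det = continuant d (n + 1) fun i ↦ w (i + 1) := by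
      refine ih (n + 1) (by omega) _ _ (fun i ↦ hd _) (fun i j hij ↦ ?_) fun i j hij ↦ ?_
      · rw [Matrix.submatrix_apply, Matrix.submatrix_apply, hw _ _ (by simp; omega)]
        simp
      · rw [Matrix.submatrix_apply, h0 _ _ (by simp; omega)]
    have hss : (A.submatrix (fun i : Fin n ↦ i.succ.succ) fun i : Fin n ↦ i.succ.succ).det =
        continuant d n fun i ↦ w (i + 2) := by
      refine ih n (by omega) _ _ (fun i ↦ hd _) (fun i j hij ↦ ?_) fun i j hij ↦ ?_
      · rw [Matrix.submatrix_apply, Matrix.submatrix_apply, hw _ _ (by simp; omega)]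
        simp
      · rw [Matrix.submatrix_apply, h0 _ _ (by simp; omega)]
    have h1 : (A.submatrix Fin.succ (Fin.succAbove 1)).det =
        A 1 0 * continuant d n fun i ↦ w (i + 2) := by
      rw [Matrix.det_succ_column_zero, Fin.sum_univ_succ, Finset.sum_eq_zero, ← hss]
      · simp only [Matrix.submatrix_submatrix, Matrix.submatrix_apply, Fin.val_zero, pow_zero,
          one_mul, add_zero]
        rfl
      · intro i _
        have : A i.succ.succ 0 = 0 := h0 _ _ (.inr (by simp))
        simp [this]
    rw [Matrix.det_succ_row_zero, Fin.sum_univ_succ, Fin.sum_univ_succ, Finset.sum_eq_zero]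
    · have h2 : A 0 1 * A 1 0 = w 0 := hw 0 1 (by simp)
      have h3 : (A.submatrix Fin.succ (Fin.succAbove (Fin.succ 0))).det =
        A 1 0 * continuant d n fun i ↦ w (i + 2) := h1
      rw [h3]
      simp only [Fin.val_zero, pow_zero, one_mul, Fin.succAbove_zero, hs, hd, Fin.val_one,
        pow_one, add_zero, continuant, ← h2, Fin.succ_zero_eq_one]
      ring
    · intro i _
      rw [h0 0 i.succ.succ (.inl (by simp))]
      ring

/-- The off-diagonal products for a path of `a` long roots followed by short ones. -/
def laceWeight (a i : ℕ) : ℝ[X] := if i + 1 = a then 2 * X else X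

lemma laceWeight_succ (a : ℕ) :
    (fun i ↦ laceWeight (a + 1) (i + 1)) = laceWeight a := by
  ext1 i
  simp [laceWeight]

lemma laceWeight_zero_succ (k : ℕ) :
    (fun i ↦ laceWeight 0 (i + k)) = laceWeight 0 := by
  ext1 i
  simp [laceWeight]

lemma continuant_typeB (a : ℕ) :
    continuant (X + 1 : ℝ[X]) (a + 1) (laceWeight a) = X ^ (a + 1) + 1 := by
  induction a using Nat.strong_induction_on with
  | _ a ih =>
  match a with
  | 0 => simp [continuant]
  | 1 =>
    simp [continuant, laceWeight]
    ring
  | a + 2 =>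
    have h1 := ih (a + 1) (by omega)
    have h2 := ih a (by omega)
    have h3 : (fun i ↦ laceWeight (a + 2) (i + 2)) = laceWeight a := by
      ext1 i
      simp [laceWeight]
    rw [continuant, laceWeight_succ, h1, h3, h2]
    simp only [laceWeight, zero_add]
    rw [if_neg (by omega)]
    ring

lemma continuant_simplyLaced (n : ℕ) :
    continuant (X + 1 : ℝ[X]) (n + 1) (laceWeight 0) =
      continuant (X + 1) n (laceWeight 0) + X ^ (n + 1) ∧
    continuant (X + 1 : ℝ[X]) (n + 1) (laceWeight 0) =
      X * continuant (X + 1) n (laceWeight 0) + 1 := by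
  induction n with
  | zero =>
    simp only [continuant]
    constructor <;> ring
  | succ n ih =>
    obtain ⟨h1, h2⟩ := ih
    have h3 : continuant (X + 1 : ℝ[X]) (n + 2) (laceWeight 0) =
        (X + 1) * continuant (X + 1) (n + 1) (laceWeight 0) -
          X * continuant (X + 1) n (laceWeight 0) := by
      rw [continuant, laceWeight_zero_succ, laceWeight_zero_succ]
      simp [laceWeight]
    constructor
    · rw [h3]
      linear_combination X * h1
    · rw [h3]
      linear_combination h2

lemma continuant_typeC (N : ℕ) (hN : 0 < N) :
    continuant (X + 1 : ℝ[X]) (N + 1) (laceWeight 1) = X ^ (N + 1) + 1 := by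
  obtain ⟨m, rfl⟩ : ∃ m, N = m + 1 := ⟨N - 1, by omega⟩
  have h3 : (fun i ↦ laceWeight 1 (i + 2)) = laceWeight 0 := by
    ext1 i
    simp [laceWeight]
  rw [continuant, laceWeight_succ, h3]
  obtain ⟨h1, h2⟩ := continuant_simplyLaced m
  simp only [laceWeight, zero_add, if_true]
  linear_combination X * h1 + h2

lemma continuant_typeF :
    continuant (X + 1 : ℝ[X]) 4 (laceWeight 2) = X ^ 4 - X ^ 2 + 1 := by
  simp [continuant, laceWeight]
  ring

end Tridiagonal

/-! ### The characteristic polynomial of a Coxeter element -/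

section Coxeter

variable {ι M N : Type*} [AddCommGroup M] [Module ℝ M] [AddCommGroup N] [Module ℝ N]
  {P : RootPairing ι ℝ M N}

open Classical in
/-- A product of distinct reflections subtracts from `v` a combination of the corresponding roots,
whose coefficients solve a triangular system. -/
lemma exists_coeff_prod_reflection (l : List ι) (hl : l.Nodup) (v : M) :
    ∃ y : ι → ℝ, (l.map P.reflection).prod v = v - ∑ k ∈ l.toFinset, y k • P.root k ∧
      ∀ k ∈ l, y k + ∑ j ∈ l.toFinset with l.idxOf k < l.idxOf j, y j * P.pairing j k =
        P.coroot' k v := by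
  induction l with
  | nil => exact ⟨0, by simp⟩
  | cons i l ih =>
    obtain ⟨hil, hl⟩ := List.nodup_cons.1 hl
    obtain ⟨y, hy, hy'⟩ := ih hl
    have hil' : i ∉ l.toFinset := by simpa using hil
    have hne : ∀ k ∈ l, k ≠ i := fun k hk h ↦ hil (h ▸ hk)
    refine ⟨Function.update y i (P.coroot' i ((l.map P.reflection).prod v)), ?_, fun k hk ↦ ?_⟩
    · rw [List.map_cons, List.prod_cons, LinearEquiv.mul_apply, RootPairing.reflection_apply,
        List.toFinset_cons, Finset.sum_insert hil', Function.update_self]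
      rw [Finset.sum_congr rfl fun k hk ↦ by
        rw [Function.update_of_ne (hne k (List.mem_toFinset.1 hk))]]
      conv_lhs => enter [1]; rw [hy]
      abel
    · rw [List.toFinset_cons, Finset.filter_insert]
      have hi0 : (i :: l).idxOf i = 0 := by simp
      rw [if_neg (by rw [hi0]; exact Nat.not_lt_zero _)]
      rcases eq_or_ne k i with rfl | hki
      · have h1 : {j ∈ l.toFinset | (k :: l).idxOf k < (k :: l).idxOf j} = l.toFinset := by
          refine Finset.filter_true_of_mem fun j hj ↦ ?_
          rw [hi0, List.idxOf_cons_ne _ (hne j (List.mem_toFinset.1 hj)).symm]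
          omega
        have h2 : ∀ t : ℝ, ∑ j ∈ l.toFinset, Function.update y k t j * P.pairing j k =
            ∑ j ∈ l.toFinset, y j * P.pairing j k := fun t ↦
          Finset.sum_congr rfl fun j hj ↦ by
            rw [Function.update_of_ne (hne j (List.mem_toFinset.1 hj))]
        rw [h1, Function.update_self, h2, hy, map_sub, map_sum]
        simp only [map_smul, RootPairing.root_coroot'_eq_pairing, smul_eq_mul, sub_add_cancel]
      · have hkl : k ∈ l := (List.mem_cons.1 hk).resolve_left hki
        rw [Function.update_of_ne hki, ← hy' k hkl]
        congr 1
        have h1 : {j ∈ l.toFinset | (i :: l).idxOf k < (i :: l).idxOf j} =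
            {j ∈ l.toFinset | l.idxOf k < l.idxOf j} := by
          refine Finset.filter_congr fun j hj ↦ ?_
          rw [List.idxOf_cons_ne _ (hne j (List.mem_toFinset.1 hj)).symm,
            List.idxOf_cons_ne _ hki.symm]
          omega
        rw [h1]
        refine Finset.sum_congr rfl fun j hj ↦ ?_
        rw [Function.update_of_ne (hne j (List.mem_toFinset.1 (Finset.mem_filter.1 hj).1))]

variable [FiniteDimensional ℝ M] [P.IsRootSystem] {b : P.Base} {n : ℕ} (e : Fin n ≃ b.support)

/-- Write the Cartan matrix as `U + L`, splitting its off-diagonal entries according to the order of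
the factors of the Coxeter element `c`, and its diagonal evenly. Then the matrix of `c` is
`-U⁻¹ L`, and `det U = 1`, so the characteristic polynomial is `det (X U + L)`. If the diagram is a
path, this tridiagonal determinant does not depend on the order of the factors. -/
lemma charpoly_coxeter {c : M ≃ₗ[ℝ] M} (hc : IsCoxeterElement b c) (w : ℕ → ℝ)
    (hw : ∀ i j : Fin n, (j : ℕ) = i + 1 →
      P.pairing (e i) (e j) * P.pairing (e j) (e i) = w i)
    (h0 : ∀ i j : Fin n, (i : ℕ) + 1 < j ∨ (j : ℕ) + 1 < i → P.pairing (e i) (e j) = 0)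
    (hmonic : (continuant (X + 1 : ℝ[X]) n fun i ↦ C (w i) * X).Monic) :
    (c : M →ₗ[ℝ] M).charpoly = continuant (X + 1 : ℝ[X]) n fun i ↦ C (w i) * X := by
  classical
  obtain ⟨l, hl, hmem, rfl⟩ := hc
  set c := (l.map P.reflection).prod with hcdef
  have htf : l.toFinset = b.support := by ext; simp [hmem]
  choose y hy hy' using fun j : Fin n ↦ exists_coeff_prod_reflection (P := P) l hl (P.root (e j))
  let bs : Module.Basis (Fin n) ℝ M := b.toWeightBasis.reindex e.symm
  have hbs : ∀ i, bs i = P.root (e i) := fun i ↦ by simp [bs]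
  set pos : Fin n → ℕ := fun i ↦ l.idxOf (e i : ι) with hpos
  have hposinj : ∀ i j, pos i = pos j → i = j := by
    intro i j hij
    have h1 : (e i : ι) = e j := by
      refine (List.idxOf_inj ((hmem _).2 (e i).2)).1 hij
    exact e.injective (Subtype.ext h1)
  let Y : Matrix (Fin n) (Fin n) ℝ := .of fun i j ↦ y j (e i)
  let U : Matrix (Fin n) (Fin n) ℝ := .of fun i j ↦
    if i = j then 1 else if pos i < pos j then P.pairing (e j) (e i) else 0
  let L : Matrix (Fin n) (Fin n) ℝ := .of fun i j ↦
    if i = j then 1 else if pos j < pos i then P.pairing (e j) (e i) else 0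
  have hsum : ∀ f : ι → M, ∑ k ∈ l.toFinset, f k = ∑ i : Fin n, f (e i) := by
    intro f
    rw [htf, ← Finset.sum_coe_sort, ← e.sum_comp]
  have hmat : LinearMap.toMatrix bs bs (c : M →ₗ[ℝ] M) = 1 - Y := by
    ext i j
    rw [LinearMap.toMatrix_apply, hbs, LinearEquiv.coe_coe, hy, hsum, map_sub, map_sum,
      Finsupp.sub_apply, Finsupp.finsetSum_apply, Finset.sum_eq_single_of_mem i (by simp)]
    · rw [map_smul, ← hbs, ← hbs, bs.repr_self, bs.repr_self, Matrix.sub_apply, Matrix.one_apply]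
      simp [Finsupp.single_apply, Y, eq_comm]
    · intro k _ hk
      rw [map_smul, ← hbs, bs.repr_self]
      simp [hk]
  have hUY : U * Y = U + L := by
    ext i j
    have h1 := hy' j (e i) ((hmem _).2 (e i).2)
    have h2 : ∑ k ∈ l.toFinset with l.idxOf (e i : ι) < l.idxOf k,
        y j k * P.pairing k (e i) =
        ∑ k : Fin n, if pos i < pos k then y j (e k) * P.pairing (e k) (e i) else 0 := by
      rw [Finset.sum_filter, htf, ← Finset.sum_coe_sort, ← e.sum_comp]
    have h3 : (U * Y) i j = y j (e i) +
        ∑ k : Fin n, if pos i < pos k then y j (e k) * P.pairing (e k) (e i) else 0 := by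
      have h4 : y j (e i) = ∑ k : Fin n, if i = k then y j (e k) else 0 := by simp
      rw [Matrix.mul_apply, h4, ← Finset.sum_add_distrib]
      refine Finset.sum_congr rfl fun k _ ↦ ?_
      simp only [U, Y, Matrix.of_apply]
      rcases eq_or_ne i k with rfl | hik
      · simp
      · simp only [hik, if_false, zero_add]
        split_ifs <;> ring
    rw [h3, ← h2, h1, RootPairing.root_coroot'_eq_pairing]
    simp only [Matrix.add_apply, U, L, Matrix.of_apply]
    rcases eq_or_ne i j with rfl | hij
    · simp
      norm_num
    · have h5 : pos i ≠ pos j := fun h ↦ hij (hposinj i j h)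
      simp only [hij, if_false]
      split_ifs <;> first | omega | simp
  have hUC : U * LinearMap.toMatrix bs bs (c : M →ₗ[ℝ] M) = -L := by
    rw [hmat, mul_sub, hUY, mul_one]
    abel
  have hprod : U.map C * (LinearMap.toMatrix bs bs (c : M →ₗ[ℝ] M)).charmatrix =
      (X : ℝ[X]) • U.map C + L.map C := by
    have h1 : U.map C * (LinearMap.toMatrix bs bs (c : M →ₗ[ℝ] M)).map C =
        -(L.map (C : ℝ →+* ℝ[X])) := by
      rw [← Matrix.map_mul, hUC]
      ext i j
      simp
    rw [Matrix.charmatrix, mul_sub, RingHom.mapMatrix_apply, h1, sub_neg_eq_add,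
      Matrix.scalar_apply, ← Matrix.smul_one_eq_diagonal, mul_smul_comm, mul_one]
  have hdet := congrArg Matrix.det hprod
  rw [Matrix.det_mul, ← Matrix.charpoly, LinearMap.charpoly_toMatrix,
    det_eq_continuant (X + 1) n ((X : ℝ[X]) • U.map C + L.map C) fun i ↦ C (w i) * X] at hdet
  · have hu : (U.map C).det = C U.det := by
      rw [← RingHom.mapMatrix_apply, ← RingHom.map_det]
    rw [hu] at hdet
    -- Both sides have leading coefficient `1` up to the factor `det U`.
    have hlead := congrArg leadingCoeff hdet
    rw [leadingCoeff_mul, leadingCoeff_C, (LinearMap.charpoly_monic _).leadingCoeff,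
      hmonic.leadingCoeff, mul_one] at hlead
    rwa [hlead, C_1, one_mul] at hdet
  · intro i
    simp [U, L]
  · intro i j hij
    have hne : i ≠ j := by
      rintro rfl
      omega
    have h5 : pos i ≠ pos j := fun h ↦ hne (hposinj i j h)
    simp only [U, L, Matrix.add_apply, Matrix.smul_apply, Matrix.map_apply, Matrix.of_apply, hne,
      hne.symm, if_false, smul_eq_mul, ← hw i j hij, C_mul]
    rcases lt_or_gt_of_ne h5 with h | h <;> simp only [h, h.not_gt, if_true, if_false, C_0] <;> ring
  · intro i j hij
    have hne : i ≠ j := by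
      rintro rfl
      omega
    simp [U, L, hne, h0 j i hij.symm]

end Coxeter

/-! ### Exponents -/

section Exponents

variable {M : Type*} [AddCommGroup M] [Module ℝ M] [FiniteDimensional ℝ M] (c : M ≃ₗ[ℝ] M)

lemma pow_eq_one_of_charpoly_dvd {h : ℕ} (hp : (c : M →ₗ[ℝ] M).charpoly ∣ X ^ h - 1) :
    c ^ h = 1 := by
  obtain ⟨q, hq⟩ := hp
  have h1 := congrArg (aeval (c : M →ₗ[ℝ] M)) hq
  rw [map_mul, LinearMap.aeval_self_charpoly, zero_mul, map_sub, map_pow, aeval_X, map_one,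
    sub_eq_zero] at h1
  have h2 := map_pow (LinearEquiv.automorphismGroup.toLinearMapMonoidHom (R := ℝ) (M := M)) c h
  ext x
  have h3 := LinearMap.congr_fun (h2.trans h1) x
  exact h3

lemma pow_eq_one_of_isRoot {d : ℕ} (hd : c ^ d = 1) {z : ℂ}
    (hz : ((c : M →ₗ[ℝ] M).charpoly.map (algebraMap ℝ ℂ)).IsRoot z) : z ^ d = 1 := by
  classical
  let bs := Module.finBasis ℝ M
  set A := LinearMap.toMatrix bs bs (c : M →ₗ[ℝ] M) with hA
  have h1 : A ^ d = 1 := by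
    have h2 := map_pow (LinearEquiv.automorphismGroup.toLinearMapMonoidHom (R := ℝ) (M := M)) c d
    rw [hd, map_one] at h2
    rw [hA, LinearMap.toMatrix_pow]
    exact (congrArg (LinearMap.toMatrix bs bs) h2.symm).trans (LinearMap.toMatrix_one bs)
  rw [← LinearMap.charpoly_toMatrix _ bs, ← hA, ← Matrix.charpoly_map,
    ← Matrix.mem_spectrum_iff_isRoot_charpoly] at hz
  have h2 := spectrum.pow_mem_pow (A.map (algebraMap ℝ ℂ)) d hz
  have h3 : A.map (algebraMap ℝ ℂ) ^ d = 1 := by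
    rw [← Matrix.map_pow, h1]
    simp
  rw [h3] at h2
  by_contra hne
  rw [spectrum.mem_iff] at h2
  apply h2
  have h4 : algebraMap ℂ (Matrix (Fin (Module.finrank ℝ M)) (Fin (Module.finrank ℝ M)) ℂ) (z ^ d) -
      1 = algebraMap ℂ _ (z ^ d - 1) := by simp
  rw [h4]
  exact (IsUnit.mk0 _ (sub_ne_zero.2 hne)).map _

/-- The `m`-th power of the standard primitive `h`-th root of unity. -/
def unityRoot (h m : ℕ) : ℂ := Complex.exp (2 * Real.pi * Complex.I * ((m : ℂ) / (h : ℂ)))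

lemma unityRoot_eq_pow (h m : ℕ) :
    unityRoot h m = Complex.exp (2 * Real.pi * Complex.I / h) ^ m := by
  rw [unityRoot, ← Complex.exp_nat_mul]
  congr 1
  ring

lemma unityRoot_pow_eq_one_iff {h : ℕ} (hh : h ≠ 0) (m k : ℕ) :
    unityRoot h m ^ k = 1 ↔ h ∣ m * k := by
  rw [unityRoot_eq_pow, ← pow_mul, (Complex.isPrimitiveRoot_exp h hh).pow_eq_one_iff_dvd]

lemma orderOf_eq_of_charpoly_dvd {h : ℕ} (hh : h ≠ 0)
    (hp : (c : M →ₗ[ℝ] M).charpoly ∣ X ^ h - 1)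
    (hroot : ((c : M →ₗ[ℝ] M).charpoly.map (algebraMap ℝ ℂ)).IsRoot (unityRoot h 1)) :
    orderOf c = h := by
  refine Nat.dvd_antisymm (orderOf_dvd_of_pow_eq_one (pow_eq_one_of_charpoly_dvd c hp)) ?_
  have h1 := pow_eq_one_of_isRoot c (pow_orderOf_eq_one c) hroot
  rwa [unityRoot_pow_eq_one_iff hh, one_mul] at h1

open Classical in
/-- If the characteristic polynomial of `c` divides `X ^ h - 1`, its roots are simple, so the
exponents form a set. -/
lemma exponents_eq_of_charpoly_dvd {h : ℕ} (hh : h ≠ 0)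
    (hp : (c : M →ₗ[ℝ] M).charpoly ∣ X ^ h - 1)
    (hroot : ((c : M →ₗ[ℝ] M).charpoly.map (algebraMap ℝ ℂ)).IsRoot (unityRoot h 1)) :
    exponents c = ({m ∈ Finset.range h |
      ((c : M →ₗ[ℝ] M).charpoly.map (algebraMap ℝ ℂ)).IsRoot (unityRoot h m)}).val := by
  have hsep : ((c : M →ₗ[ℝ] M).charpoly.map (algebraMap ℝ ℂ)).Separable := by
    have h1 : (X ^ h - 1 : ℂ[X]).Separable := by
      rw [X_pow_sub_one_separable_iff]
      exact_mod_cast hh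
    refine h1.of_dvd ?_
    simpa using Polynomial.map_dvd (algebraMap ℝ ℂ) hp
  rw [exponents, orderOf_eq_of_charpoly_dvd c hh hp hroot, ← Finset.sum_multiset_singleton,
    Finset.sum_filter]
  refine Finset.sum_congr rfl fun m _ ↦ ?_
  rw [← unityRoot]
  split_ifs with hm
  · have h1 := (rootMultiplicity_pos hsep.ne_zero).2 hm
    have h2 := rootMultiplicity_le_one_of_separable hsep (unityRoot h m)
    rw [show rootMultiplicity (unityRoot h m) _ = 1 by omega, Multiset.replicate_one]
  · rw [rootMultiplicity_eq_zero hm, Multiset.replicate_zero]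

/-- The roots of `X ^ n + 1` give the exponents `1, 3, …, 2n - 1`. -/
lemma prod_exponents_of_charpoly_eq {n : ℕ} (hn : n ≠ 0)
    (hp : (c : M →ₗ[ℝ] M).charpoly = X ^ n + 1) (F : ℕ → ℝ) :
    ((exponents c).map F).prod = ∏ k ∈ Finset.range n, F (2 * k + 1) := by
  classical
  have hr : ∀ m, ((c : M →ₗ[ℝ] M).charpoly.map (algebraMap ℝ ℂ)).IsRoot (unityRoot (2 * n) m) ↔
      m % 2 = 1 := by
    intro m
    have h1 := unityRoot_pow_eq_one_iff (h := 2 * n) (by omega) m n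
    have h2 := unityRoot_pow_eq_one_iff (h := 2 * n) (by omega) m (2 * n)
    rw [mul_comm 2 n, pow_mul, sq_eq_one_iff] at h2
    have h3 := h2.2 (by simp)
    rw [mul_comm 2 n] at *
    rw [mul_comm m n, Nat.mul_dvd_mul_iff_left (by omega)] at h1
    rw [hp, IsRoot]
    simp only [Polynomial.map_add, Polynomial.map_pow, map_X, Polynomial.map_one, eval_add,
      eval_pow, eval_X, eval_one]
    constructor
    · intro h
      by_contra hm
      rw [h1.2 (by omega)] at h
      norm_num at h
    · intro hm
      rw [h3.resolve_left fun h ↦ by have := h1.1 h; omega]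
      norm_num
  rw [exponents_eq_of_charpoly_dvd c (h := 2 * n) (by omega) ?_ ((hr 1).2 rfl)]
  · change ∏ m ∈ Finset.filter _ _, F m = _
    symm
    refine Finset.prod_nbij (fun k ↦ 2 * k + 1) (fun k hk ↦ ?_) (fun i _ j _ hij ↦ ?_)
      (fun m hm ↦ ?_) fun k _ ↦ rfl
    · rw [Finset.mem_filter, hr]
      simp only [Finset.mem_range] at hk ⊢
      omega
    · simp only at hij
      omega
    · rw [Finset.mem_coe, Finset.mem_filter, hr, Finset.mem_range] at hm
      refine ⟨m / 2, ?_, ?_⟩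
      · simp only [Finset.coe_range, Set.mem_Iio]
        omega
      · simp only
        omega
  · rw [hp]
    exact ⟨X ^ n - 1, by ring⟩

/-- The roots of `X ^ 4 - X ^ 2 + 1` give the exponents `1, 5, 7, 11`. -/
lemma prod_exponents_of_charpoly_eq' (hp : (c : M →ₗ[ℝ] M).charpoly = X ^ 4 - X ^ 2 + 1)
    (F : ℕ → ℝ) : ((exponents c).map F).prod = F 1 * F 5 * F 7 * F 11 := by
  classical
  have hr : ∀ m, ((c : M →ₗ[ℝ] M).charpoly.map (algebraMap ℝ ℂ)).IsRoot (unityRoot 12 m) ↔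
      m % 2 = 1 ∧ m % 3 ≠ 0 := by
    intro m
    have h12 := (unityRoot_pow_eq_one_iff (h := 12) (by omega) m 12).2 (by simp)
    have h6 := unityRoot_pow_eq_one_iff (h := 12) (by omega) m 6
    have h4 := unityRoot_pow_eq_one_iff (h := 12) (by omega) m 4
    have h2 := unityRoot_pow_eq_one_iff (h := 12) (by omega) m 2
    rw [hp, IsRoot]
    simp only [Polynomial.map_add, Polynomial.map_sub, Polynomial.map_pow, map_X,
      Polynomial.map_one, eval_add, eval_sub, eval_pow, eval_X, eval_one]
    generalize unityRoot 12 m = z at *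
    constructor
    · intro h
      have h7 : z ^ 6 = -1 := by linear_combination (z ^ 2 + 1) * h
      constructor
      · by_contra hm
        rw [h6.2 (by omega)] at h7
        norm_num at h7
      · intro hm
        have h8 := h4.2 (by omega)
        have h9 : z ^ 2 = -1 := by
          rw [← h7]
          linear_combination (-z ^ 2) * h8
        have h10 : z ^ 2 = 2 := by linear_combination h8 - h
        rw [h10] at h9
        norm_num at h9
    · rintro ⟨hm, hm'⟩
      have h7 : z ^ 6 = -1 := by
        have h8 : (z ^ 6) ^ 2 = 1 := by rw [← pow_mul, h12]
        exact (sq_eq_one_iff.1 h8).resolve_left fun h ↦ by have := h6.1 h; omega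
      have h9 : z ^ 2 + 1 ≠ 0 := by
        intro h9
        have h10 : z ^ 4 = 1 := by linear_combination (z ^ 2 - 1) * h9
        have := h4.1 h10
        omega
      refine (mul_eq_zero.1 ?_).resolve_left h9
      linear_combination h7
  rw [exponents_eq_of_charpoly_dvd c (h := 12) (by omega) ?_ ((hr 1).2 (by omega))]
  · change ∏ m ∈ Finset.filter _ _, F m = _
    simp only [hr]
    have : {m ∈ Finset.range 12 | m % 2 = 1 ∧ m % 3 ≠ 0} = ({1, 5, 7, 11} : Finset ℕ) := by decide
    rw [this]
    simp [mul_assoc]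
  · rw [hp]
    exact ⟨(X ^ 6 - 1) * (X ^ 2 + 1), by ring⟩

end Exponents

/-! ### Products over the exponents -/

lemma prod_typeB (n : ℕ) :
    ∏ k ∈ Finset.range n, ((2 : ℝ) + (2 * k + 1 : ℕ) + 1) / ((2 * k + 1 : ℕ) + 1) = n + 1 := by
  induction n with
  | zero => simp
  | succ n ih =>
    rw [Finset.prod_range_succ, ih]
    push_cast
    field_simp
    ring

lemma prod_add_div (r m : ℕ) :
    ∏ k ∈ Finset.range m, ((r + k + 1 : ℝ) / (k + 1)) = ((r + m).choose m : ℝ) := by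
  induction m with
  | zero => simp
  | succ m ih =>
    rw [Finset.prod_range_succ, ih, mul_div_assoc', div_eq_iff (by positivity)]
    have h := Nat.add_one_mul_choose_eq (r + m) m
    have h' : ((r + m + 1 : ℕ) : ℝ) * ((r + m).choose m : ℝ) =
        ((r + m + 1).choose (m + 1) : ℝ) * ((m + 1 : ℕ) : ℝ) := by exact_mod_cast h
    push_cast at h'
    rw [show r + (m + 1) = r + m + 1 by ring, ← h']
    ring

lemma prod_typeC (N : ℕ) :
    ∏ k ∈ Finset.range (N + 1),
      (2 * (((N + 1 : ℕ) : ℝ) - 1) + (2 * k + 1 : ℕ) + 1) / ((2 * k + 1 : ℕ) + 1) =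
      ((2 * N + 1).choose N : ℝ) := by
  have h : (2 * N + 1).choose N = (N + (N + 1)).choose (N + 1) := by
    rw [← Nat.choose_symm_of_eq_add (a := N + 1) (b := N) (by ring)]
    congr 1
    ring
  rw [h, ← prod_add_div]
  refine Finset.prod_congr rfl fun k _ ↦ ?_
  push_cast
  rw [div_eq_div_iff (by positivity) (by positivity)]
  ring

/-! ### Coxeter elements of a doubly laced path -/

section Coxeter

variable {ι M N : Type*} [AddCommGroup M] [Module ℝ M] [AddCommGroup N] [Module ℝ N]
  {P : RootPairing ι ℝ M N} [FiniteDimensional ℝ M] [P.IsRootSystem] {b : P.Base} {n : ℕ}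
  {e : Fin n ≃ b.support} {B : P.InvariantForm} {a : ℕ} {l : ℝ}

/-- The characteristic polynomial of a Coxeter element of a doubly laced path. -/
lemma charpoly_coxeter_path
    (he : ∀ i j : Fin n, B.form (P.root (e i)) (P.root (e j)) = l / 2 * gram a i j) (hl : 0 < l)
    {c : M ≃ₗ[ℝ] M} (hc : IsCoxeterElement b c)
    (hmonic : (continuant (X + 1 : ℝ[X]) n (laceWeight a)).Monic) :
    (c : M →ₗ[ℝ] M).charpoly = continuant (X + 1 : ℝ[X]) n (laceWeight a) := by
  have hw : laceWeight a = fun i ↦ C (if i + 1 = a then (2 : ℝ) else 1) * X := by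
    ext1 i
    unfold laceWeight
    split_ifs
    · rw [map_ofNat C 2]
    · rw [map_one, one_mul]
  have hpair : ∀ i j : Fin n, P.pairing (e i) (e j) * gram a j j = 2 * gram a i j := by
    intro i j
    have h1 := B.two_mul_apply_root_root (e i) (e j)
    rw [he, he] at h1
    have h2 : l * (P.pairing (e i) (e j) * gram a j j) = l * (2 * gram a i j) := by linarith
    exact mul_left_cancel₀ hl.ne' h2
  have hdiag : ∀ i : Fin n, (gram a i i : ℝ) = if (i : ℕ) < a then 4 else 2 := by
    intro i
    simp only [gram, if_true]
    split_ifs <;> norm_num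
  rw [hw] at hmonic ⊢
  refine charpoly_coxeter e hc _ (fun i j hij ↦ ?_) (fun i j hij ↦ ?_) hmonic
  · have h1 := hpair i j
    have h2 := hpair j i
    have h3 : (gram a i j : ℝ) = if (i : ℕ) < a then -2 else -1 := by
      rw [gram, if_neg (by omega), if_pos (by omega)]
      split_ifs <;> norm_num
    rw [gram_comm a j i] at h2
    rw [h3, hdiag] at h1 h2
    split_ifs at h1 h2 ⊢ <;> first | omega | nlinarith
  · have h1 := hpair i j
    have h2 : gram a i j = 0 := by
      unfold gram
      split_ifs <;> omega
    rw [h2, hdiag] at h1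
    split_ifs at h1 <;> simpa using h1

end Coxeter

end ShortAntichain

end

theorem mainTheorem1 {ι M N : Type*} [Finite ι]
    [AddCommGroup M] [Module ℝ M] [FiniteDimensional ℝ M] [AddCommGroup N] [Module ℝ N]
    (P : RootPairing ι ℝ M N) [P.IsRootSystem] [P.IsCrystallographic] [P.IsReduced]
    [P.IsIrreducible] (b : P.Base)
    (B : P.InvariantForm) (hB : ∀ x : M, x ≠ 0 → 0 < B.form x x)
    (θ θs : ι) (hθ : ShortAntichain.IsHighestRoot b θ)
    (hθs : ShortAntichain.IsShort B θs) (hθs' : ShortAntichain.IsDominantRoot b B θs)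
    (hratio : ShortAntichain.sqLength B θ / ShortAntichain.sqLength B θs = 2)
    (c : M ≃ₗ[ℝ] M) (hc : ShortAntichain.IsCoxeterElement b c) :
    ((ShortAntichain.shortAntichains b B).ncard : ℝ) =
      ((ShortAntichain.exponents c).map fun e : ℕ =>
        (ShortAntichain.shortCoordSum b B θ + e + 1) / ((e : ℝ) + 1)).prod := by
  open ShortAntichain Polynomial in
  set l := sqLength B θs with hl_def
  have hl : 0 < l := sqLength_pos B hB θs
  have hθl : sqLength B θ = 2 * l := (div_eq_iff hl.ne').1 hratio
  have hlen : ∀ i, sqLength B i = l ∨ sqLength B i = 2 * l := by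
    intro i
    rw [← hθl]
    refine B.apply_eq_or_of_apply_ne (i := θs) (j := θ) ?_ i
    change l ≠ sqLength B θ
    linarith
  have hD := isDoublyLaced b B hB hl hlen
  have hsimple : ∀ i, ∃ j : b.support,
      ((2 / l) • B.form) (P.root j) (P.root j) = 2 / l * sqLength B i := by
    intro i
    obtain ⟨j, hj, h⟩ := exists_simple_sqLength_eq b B i
    exact ⟨⟨j, hj⟩, by rw [← h]; rfl⟩
  obtain ⟨n, a, e, he, ha, han, htype⟩ := hD.classification
    (by obtain ⟨j, hj⟩ := hsimple θs
        exact ⟨j, by rw [hj, ← hl_def]; field_simp⟩)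
    (by obtain ⟨j, hj⟩ := hsimple θ
        exact ⟨j, by rw [hj, hθl]; field_simp; norm_num⟩)
  replace he : ∀ i j : Fin n, B.form (P.root (e i)) (P.root (e j)) = l / 2 * gram a i j := by
    intro i j
    rw [← he i j, LinearMap.smul_apply, LinearMap.smul_apply, smul_eq_mul]
    field_simp
  rw [ncard_shortAntichains b e he hl hlen hB hθl]
  have hmonic : ∀ k : ℕ, (X ^ (k + 1) + 1 : ℝ[X]).Monic := fun k ↦ by
    simpa using monic_X_pow_add_C (1 : ℝ) k.succ_ne_zero
  rcases htype with rfl | rfl | ⟨rfl, rfl⟩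
  · have hp := charpoly_coxeter_path he hl hc (by rw [continuant_typeB]; exact hmonic a)
    rw [continuant_typeB] at hp
    rw [prod_exponents_of_charpoly_eq c a.succ_ne_zero hp,
      shortCoordSum_typeB hθ he hl hlen hθl rfl, prod_typeB, ncard_antichainsIn_typeB]
    push_cast
    ring
  · obtain ⟨N, rfl⟩ : ∃ N, n = N + 1 := ⟨n - 1, by omega⟩
    have hp := charpoly_coxeter_path he hl hc
      (by rw [continuant_typeC N (by omega)]; exact hmonic N)
    rw [continuant_typeC N (by omega)] at hp
    rw [prod_exponents_of_charpoly_eq c N.succ_ne_zero hp,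
      shortCoordSum_typeC hθ he hl hlen hθl rfl han, prod_typeC, ncard_antichainsIn_typeC]
  · have hp := charpoly_coxeter_path he hl hc (by
      rw [continuant_typeF]
      monicity!)
    rw [continuant_typeF] at hp
    rw [prod_exponents_of_charpoly_eq' c hp,
      shortCoordSum_typeF hθ he hl hlen hθl rfl rfl, ncard_antichainsIn_typeF]
    norm_num
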